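/- **Network.** Let $\mathcal V,\mathcal G,\mathcal E$ be finite sets of buses, generating units and lines; each unit is located at a bus, and each line $l$ runs from a bus $f_l$ to a bus $t_l$. Let $\mathbf C\in\{0,1\}^{\mathcal G\times\mathcal V}$ and $\vec{\mathbf C},\overleftarrow{\mathbf C}\in\{0,1\}^{\mathcal E\times\mathcal V}$ be the unit, *from* and *to* incidence matrices. Each line is a linear two-port with complex admittances $y^{ff}_l,y^{ft}_l,y^{tf}_l,y^{tt}_l$ (the $\pi$-model with a tap-changing and phase-shifting transformer is a special case). The branch admittance matrices are $\vec{\mathbf Y}=[\mathbf y^{ff}]\vec{\mathbf C}+[\mathbf y^{ft}]\overleftarrow{\mathbf C}$ and $\overleftarrow{\mathbf Y}=[\mathbf y^{tf}]\vec{\mathbf C}+[\mathbf y^{tt}]\overleftarrow{\mathbf C}$, and the nodal admittance matrix is $\mathbf Y=[\mathbf y_{\rm sh}]+\vec{\mathbf C}^{\top}\vec{\mathbf Y}+\overleftarrow{\mathbf C}^{\top}\overleftarrow{\mathbf Y}$, where $\mathbf y_{\rm sh}\in\mathbb C^{\mathcal V}$ are shunt admittances and $[\cdot]$ denotes a diagonal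 matrix. Let $\mathbf d\in\mathbb C^{\mathcal V}$ be the demands, let $\mathbf v_{\min},\mathbf v_{\max}\in\mathbb R^{\mathcal V}$, $\mathbf p_{\min},\mathbf p_{\max},\mathbf q_{\min},\mathbf q_{\max}\in\mathbb R^{\mathcal G}$, $\mathbf f_{\max}\in\mathbb R^{\mathcal E}$ be limits and $\mathbf c_0,\mathbf c_1,\mathbf c_2\in\mathbb R_{\ge 0}^{\mathcal G}$ cost coefficients. **OPF.** The optimal power flow problem is to minimize $h(\mathbf p)=\sum_g (c_{0,g}+c_{1,g}p_g+c_{2,g}p_g^2)$ over $\mathbf x=(\mathbf v,\mathbf p+\mathrm i\mathbf q,\vec{\mathbf s},\overleftarrow{\mathbf s})\in\mathbb C^{\mathcal V}\times\mathbb C^{\mathcal G}\times\mathbb C^{\mathcal E}\times\mathbb C^{\mathcal E}$ subject to, with squares and absolute values taken entrywise, $$\mathbf d+\mathrm{diag}(\mathbf v\mathbf v^*\mathbf Y^*)=\mathbf C^{\top}(\mathbf p+\mathrm i\mathbf q),\quad \mathrm{diag}(\vec{\mathbf C}\mathbf v\mathbf v^*\vec{\mathbf Y}^*)=\vec{\mathbf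 s},\quad \mathrm{diag}(\overleftarrow{\mathbf C}\mathbf v\mathbf v^*\overleftarrow{\mathbf Y}^*)=\overleftarrow{\mathbf s},$$ $$\mathbf v_{\min}^2\le|\mathbf v|^2\le\mathbf v_{\max}^2,\quad \mathbf p_{\min}\le\mathbf p\le\mathbf p_{\max},\quad \mathbf q_{\min}\le\mathbf q\le\mathbf q_{\max},\quad |\vec{\mathbf s}|^2\le\mathbf f_{\max}^2,\quad |\overleftarrow{\mathbf s}|^2\le\mathbf f_{\max}^2 .$$ A feasible point satisfies LICQ if the gradients there (with respect to the real and imaginary parts of all variables) of the real and imaginary parts of all the equations, together with the gradients of those quantities among $|v_k|^2$, $p_g$, $q_g$, $|\vec s_l|^2$, $|\overleftarrow s_l|^2$ that attain one of their bounds (each quantity counted once), are linearly independent. **Cones.** Let $\mathcal C_1$ be the cone of Hermitian positive semidefinite $\mathcal V\times\mathcal V$ matrices, $\mathcal C_2$ the set of Hermitian $\mathbf H$ with $H_{ii}\ge0$ for all buses $i$ and $H_{ii}H_{jj}\ge|H_{ij}|^2$ for every line from $i$ to $j$, and $\mathcal C_3$ the set of Hermitian $\mathbf H$ with $H_{ii}\ge0$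 for all buses $i$ and $H_{ii}+H_{jj}\ge2|\mathrm{Re}\,H_{ij}|$, $H_{ii}+H_{jj}\ge2|\mathrm{Im}\,H_{ij}|$ for every line from $i$ to $j$. Let $\mathcal D_k$ be the dual cone of $\mathcal C_k$ in the Hermitian matrices under $\langle\mathbf H,\mathbf M\rangle=\mathrm{tr}(\mathbf H\mathbf M)$, and put $\mathrm{int}\,\mathcal D_k=\{\mathbf M \text{ Hermitian}: \mathbf M-\varepsilon\mathbf I\in\mathcal D_k\text{ for some }\varepsilon>0\}$. **Penalized relaxation.** For a Hermitian $\mathbf M$, a point $\mathbf x_0=(\mathbf v_0,\mathbf p_0+\mathrm i\mathbf q_0,\vec{\mathbf s}_0,\overleftarrow{\mathbf s}_0)$ and $\mu>0$, minimize $\sum_g(c_{0,g}+c_{1,g}p_g+c_{2,g}o_g)+\mu\,\kappa_{\mathbf M,\mathbf x_0}$ over Hermitian $\mathbf W$, $\mathbf o,\mathbf r\in\mathbb R^{\mathcal G}$, $\vec{\mathbf f},\overleftarrow{\mathbf f}\in\mathbb R^{\mathcal E}$ and $(\mathbf v,\mathbf p+\mathrm i\mathbf q,\vec{\mathbf s},\overleftarrow{\mathbf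 s})$, where $$\begin{aligned}\kappa_{\mathbf M,\mathbf x_0}={}&(\mathbf o^{\top}\mathbf 1-2\mathbf p_0^{\top}\mathbf p+\mathbf p_0^{\top}\mathbf p_0)+(\mathbf r^{\top}\mathbf 1-2\mathbf q_0^{\top}\mathbf q+\mathbf q_0^{\top}\mathbf q_0)\\&+(\vec{\mathbf f}^{\top}\mathbf 1-\vec{\mathbf s}_0^*\vec{\mathbf s}-\vec{\mathbf s}^*\vec{\mathbf s}_0+\vec{\mathbf s}_0^*\vec{\mathbf s}_0)+(\overleftarrow{\mathbf f}^{\top}\mathbf 1-\overleftarrow{\mathbf s}_0^*\overleftarrow{\mathbf s}-\overleftarrow{\mathbf s}^*\overleftarrow{\mathbf s}_0+\overleftarrow{\mathbf s}_0^*\overleftarrow{\mathbf s}_0)\\&+\mathrm{tr}(\mathbf W\mathbf M)-\mathbf v_0^*\mathbf M\mathbf v-\mathbf v^*\mathbf M\mathbf v_0+\mathbf v_0^*\mathbf M\mathbf v_0,\end{aligned}$$ subject to the three OPF equations with $\mathbf v\mathbf v^*$ replaced by $\mathbf W$, to $\mathbf v_{\min}^2\le\mathrm{diag}(\mathbf W)\le\mathbf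 v_{\max}^2$, $\mathbf p_{\min}\le\mathbf p\le\mathbf p_{\max}$, $\mathbf q_{\min}\le\mathbf q\le\mathbf q_{\max}$, $|\vec{\mathbf s}|^2\le\vec{\mathbf f}\le\mathbf f_{\max}^2$, $|\overleftarrow{\mathbf s}|^2\le\overleftarrow{\mathbf f}\le\mathbf f_{\max}^2$, $\mathbf p^2\le\mathbf o$, $\mathbf q^2\le\mathbf r$, and to $\mathbf W-\mathbf v\mathbf v^*\in\mathcal C_k$. **Theorem.** Let $k\in\{1,2,3\}$, let $\mathbf x_0$ be a feasible point of the OPF problem that satisfies LICQ, and let $\mathbf M\in\mathrm{int}\,\mathcal D_k$. Then there is $\mu_0>0$ such that for every $\mu\ge\mu_0$ the penalized relaxation with cone $\mathcal C_k$ has an optimal solution with $\mathbf W=\mathbf v\mathbf v^*$, whose part $\mathbf x_{\rm opt}=(\mathbf v,\mathbf p+\mathrm i\mathbf q,\vec{\mathbf s},\overleftarrow{\mathbf s})$ is feasible for the OPF problem and satisfies $h(\mathbf p)\le h(\mathbf p_0)$. This solution is unique: every optimal solution coincides with it in all variables, where for $k\in\{2,3\}$ the off-diagonal entries $W_{ij}$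 with no line joining $i$ and $j$ (which then occur in no constraint and not in the objective) are disregarded. In particular it is literally unique if $k=1$, or if every two distinct buses are joined by a line. -/

import Mathlib

open Matrix
open scoped ComplexOrder

noncomputable section

/-- A power network with buses `V`, generating units `G` and lines `E`.  Every line `l` runs from
the bus `src l` to the bus `tgt l` and is a linear two-port: the currents entering it are
`yff * v_f + yft * v_t` at the *from* end and `ytf * v_f + ytt * v_t` at the *to* end.
The standard pi-model with series admittance `y`, shunt susceptance `b`, tap ratio `τ` and phase
shift `θ` is the case `yff = (y + i b / 2) / τ ^ 2`, `yft = - y e^{iθ} / τ`,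
`ytf = - y e^{-iθ} / τ`, `ytt = y + i b / 2`. -/
structure PowerNetwork (V G E : Type*) where
  /-- starting bus of a line -/
  src : E → V
  /-- ending bus of a line -/
  tgt : E → V
  /-- bus at which a generating unit is located -/
  bus : G → V
  /-- two-port admittances of the lines -/
  yff : E → ℂ
  yft : E → ℂ
  ytf : E → ℂ
  ytt : E → ℂ
  /-- shunt admittances -/
  ysh : V → ℂ
  /-- complex demand -/
  d : V → ℂ
  /-- voltage magnitude limits -/
  vmin : V → ℝ
  vmax : V → ℝ
  /-- limits on active and reactive generation -/
  pmin : G → ℝ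
  pmax : G → ℝ
  qmin : G → ℝ
  qmax : G → ℝ
  /-- thermal limits of the lines -/
  fmax : E → ℝ
  /-- fixed, linear and quadratic cost coefficients -/
  c0 : G → ℝ
  c1 : G → ℝ
  c2 : G → ℝ
  c0_nonneg : ∀ g, 0 ≤ c0 g
  c1_nonneg : ∀ g, 0 ≤ c1 g
  c2_nonneg : ∀ g, 0 ≤ c2 g

/-- Points `(v, p + i q, s→, s←)` of the optimal power flow problem. -/
abbrev OPFPoint (V G E : Type*) := (V → ℂ) × (G → ℂ) × (E → ℂ) × (E → ℂ)

namespace OPFPoint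

variable {V G E : Type*}

/-- complex bus voltages -/
def v (x : OPFPoint V G E) : V → ℂ := x.1
/-- complex generation `p + i q` -/
def s (x : OPFPoint V G E) : G → ℂ := x.2.1
/-- active generation -/
def p (x : OPFPoint V G E) (g : G) : ℝ := (x.s g).re
/-- reactive generation -/
def q (x : OPFPoint V G E) (g : G) : ℝ := (x.s g).im
/-- complex power entering the lines at their *from* ends -/
def sf (x : OPFPoint V G E) : E → ℂ := x.2.2.1
/-- complex power entering the lines at their *to* ends -/
def st (x : OPFPoint V G E) : E → ℂ := x.2.2.2

end OPFPoint

/-- The rank-one matrix `v v*`. -/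
def outer {V : Type*} (v : V → ℂ) : Matrix V V ℂ := vecMulVec v (star v)

/-- The three cones: semidefinite, second-order and parabolic. -/
inductive ConeKind
  | sdp
  | socp
  | parabolic

/-- Labels of the scalar constraints of the optimal power flow problem: real and imaginary parts
of the three families of equations, and the real quantities bounded by the inequalities. -/
inductive ConstraintLabel (V G E : Type*)
  | balanceRe (k : V)
  | balanceIm (k : V)
  | fromRe (l : E)
  | fromIm (l : E)
  | toRe (l : E)
  | toIm (l : E)
  | voltage (k : V)
  | activeGen (g : G)
  | reactiveGen (g : G)
  | fromLimit (l : E)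
  | toLimit (l : E)

/-- Variables `(W, o, r, f→, f←, v, p + i q, s→, s←)` of the lifted problem. -/
@[ext]
structure LiftedPoint (V G E : Type*) where
  W : Matrix V V ℂ
  o : G → ℝ
  r : G → ℝ
  ff : E → ℝ
  ft : E → ℝ
  x : OPFPoint V G E

namespace PowerNetwork

variable {V G E : Type*} [Fintype V] [DecidableEq V] [Fintype G] [Fintype E]
variable (N : PowerNetwork V G E)

/-! ### Incidence and admittance matrices -/

/-- unit incidence matrix -/
def Cgen : Matrix G V ℂ := Matrix.of fun g k => if N.bus g = k then 1 else 0
/-- *from* incidence matrix -/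
def Cfrom : Matrix E V ℂ := Matrix.of fun l k => if N.src l = k then 1 else 0
/-- *to* incidence matrix -/
def Cto : Matrix E V ℂ := Matrix.of fun l k => if N.tgt l = k then 1 else 0

/-- *from* branch admittance matrix -/
def Yfrom : Matrix E V ℂ :=
  Matrix.of fun l k => N.yff l * N.Cfrom l k + N.yft l * N.Cto l k
/-- *to* branch admittance matrix -/
def Yto : Matrix E V ℂ :=
  Matrix.of fun l k => N.ytf l * N.Cfrom l k + N.ytt l * N.Cto l k
/-- nodal admittance matrix -/
def Ybus : Matrix V V ℂ :=
  diagonal N.ysh + N.Cfromᵀ * N.Yfrom + N.Ctoᵀ * N.Yto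

/-! ### The optimal power flow problem -/

/-- Left side minus right side of the power balance at bus `k`, as a function of the matrix
standing for `v v*` and of `p + i q`. -/
def balance (W : Matrix V V ℂ) (s : G → ℂ) (k : V) : ℂ :=
  N.d k + (W * N.Ybusᴴ) k k - (N.Cgenᵀ *ᵥ s) k

/-- Left side minus right side of the *from* flow equation of line `l`. -/
def fromFlow (W : Matrix V V ℂ) (sf : E → ℂ) (l : E) : ℂ :=
  (N.Cfrom * W * N.Yfromᴴ) l l - sf l

/-- Left side minus right side of the *to* flow equation of line `l`. -/
def toFlow (W : Matrix V V ℂ) (st : E → ℂ) (l : E) : ℂ :=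
  (N.Cto * W * N.Ytoᴴ) l l - st l

/-- Generation cost `h`. -/
def cost (p : G → ℝ) : ℝ := ∑ g, (N.c0 g + N.c1 g * p g + N.c2 g * p g ^ 2)

/-- Feasibility for the optimal power flow problem. -/
structure OPFFeasible (x : OPFPoint V G E) : Prop where
  balance_eq : ∀ k, N.balance (outer x.v) x.s k = 0
  from_eq : ∀ l, N.fromFlow (outer x.v) x.sf l = 0
  to_eq : ∀ l, N.toFlow (outer x.v) x.st l = 0
  voltage : ∀ k, N.vmin k ^ 2 ≤ ‖x.v k‖ ^ 2 ∧ ‖x.v k‖ ^ 2 ≤ N.vmax k ^ 2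
  activeGen : ∀ g, N.pmin g ≤ x.p g ∧ x.p g ≤ N.pmax g
  reactiveGen : ∀ g, N.qmin g ≤ x.q g ∧ x.q g ≤ N.qmax g
  fromLimit : ∀ l, ‖x.sf l‖ ^ 2 ≤ N.fmax l ^ 2
  toLimit : ∀ l, ‖x.st l‖ ^ 2 ≤ N.fmax l ^ 2

/-! ### Linear independence constraint qualification -/

/-- The real function of the point that a scalar constraint sets to zero or bounds. -/
def constraintFun : ConstraintLabel V G E → OPFPoint V G E → ℝ
  | .balanceRe k, x => (N.balance (outer x.v) x.s k).re
  | .balanceIm k, x => (N.balance (outer x.v) x.s k).im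
  | .fromRe l, x => (N.fromFlow (outer x.v) x.sf l).re
  | .fromIm l, x => (N.fromFlow (outer x.v) x.sf l).im
  | .toRe l, x => (N.toFlow (outer x.v) x.st l).re
  | .toIm l, x => (N.toFlow (outer x.v) x.st l).im
  | .voltage k, x => ‖x.v k‖ ^ 2
  | .activeGen g, x => x.p g
  | .reactiveGen g, x => x.q g
  | .fromLimit l, x => ‖x.sf l‖ ^ 2
  | .toLimit l, x => ‖x.st l‖ ^ 2

/-- Equations are always active; a bounded quantity is active if it attains one of its bounds. -/
def IsActive (x : OPFPoint V G E) : ConstraintLabel V G E → Prop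
  | .balanceRe _ => True
  | .balanceIm _ => True
  | .fromRe _ => True
  | .fromIm _ => True
  | .toRe _ => True
  | .toIm _ => True
  | .voltage k => ‖x.v k‖ ^ 2 = N.vmin k ^ 2 ∨ ‖x.v k‖ ^ 2 = N.vmax k ^ 2
  | .activeGen g => x.p g = N.pmin g ∨ x.p g = N.pmax g
  | .reactiveGen g => x.q g = N.qmin g ∨ x.q g = N.qmax g
  | .fromLimit l => ‖x.sf l‖ ^ 2 = N.fmax l ^ 2
  | .toLimit l => ‖x.st l‖ ^ 2 = N.fmax l ^ 2

/-- The gradients of the active constraints at `x`, with respect to the real and imaginary parts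
of all variables, are linearly independent. -/
def LICQ (x : OPFPoint V G E) : Prop :=
  LinearIndependent ℝ
    (fun c : {c : ConstraintLabel V G E // N.IsActive x c} => fderiv ℝ (N.constraintFun c.1) x)

/-! ### Cones and dual cones -/

/-- The cones `C_1` (semidefinite), `C_2` (second-order) and `C_3` (parabolic). -/
def cone : ConeKind → Set (Matrix V V ℂ)
  | .sdp => {H | H.PosSemidef}
  | .socp => {H | H.IsHermitian ∧ (∀ i, 0 ≤ (H i i).re) ∧
      ∀ l, ‖H (N.src l) (N.tgt l)‖ ^ 2 ≤
        (H (N.src l) (N.src l)).re * (H (N.tgt l) (N.tgt l)).re}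
  | .parabolic => {H | H.IsHermitian ∧ (∀ i, 0 ≤ (H i i).re) ∧
      ∀ l, 2 * |(H (N.src l) (N.tgt l)).re| ≤
          (H (N.src l) (N.src l)).re + (H (N.tgt l) (N.tgt l)).re ∧
        2 * |(H (N.src l) (N.tgt l)).im| ≤
          (H (N.src l) (N.src l)).re + (H (N.tgt l) (N.tgt l)).re}

/-- The dual cone `D_k` in the space of Hermitian matrices with inner product `tr (H M)`. -/
def dualCone (k : ConeKind) : Set (Matrix V V ℂ) :=
  {M | M.IsHermitian ∧ ∀ H ∈ N.cone k, 0 ≤ (H * M).trace.re}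

/-- The interior of `D_k`: the Hermitian matrices `M` with `M - ε I ∈ D_k` for some `ε > 0`. -/
def dualInterior (k : ConeKind) : Set (Matrix V V ℂ) :=
  {M | M.IsHermitian ∧ ∃ ε : ℝ, 0 < ε ∧ M - (ε : ℂ) • (1 : Matrix V V ℂ) ∈ N.dualCone k}

/-- The entries of `W` that occur in the relaxation with cone `C_k`: all of them in the semidefinite
case, otherwise the diagonal ones and those whose indices are joined by a line. -/
def Occurs : ConeKind → V → V → Prop
  | .sdp, _, _ => True
  | .socp, i, j => i = j ∨ ∃ l, (N.src l = i ∧ N.tgt l = j) ∨ (N.src l = j ∧ N.tgt l = i)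
  | .parabolic, i, j => i = j ∨ ∃ l, (N.src l = i ∧ N.tgt l = j) ∨ (N.src l = j ∧ N.tgt l = i)

/-! ### The penalized relaxation -/

/-- The penalty function with penalty matrix `M` and initial point `x₀`. -/
def penalty (M : Matrix V V ℂ) (x₀ : OPFPoint V G E) (z : LiftedPoint V G E) : ℝ :=
  ((∑ g, z.o g) - 2 * (x₀.p ⬝ᵥ z.x.p) + x₀.p ⬝ᵥ x₀.p) +
  ((∑ g, z.r g) - 2 * (x₀.q ⬝ᵥ z.x.q) + x₀.q ⬝ᵥ x₀.q) +
  ((∑ l, z.ff l) +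
    (- (star x₀.sf ⬝ᵥ z.x.sf) - star z.x.sf ⬝ᵥ x₀.sf + star x₀.sf ⬝ᵥ x₀.sf).re) +
  ((∑ l, z.ft l) +
    (- (star x₀.st ⬝ᵥ z.x.st) - star z.x.st ⬝ᵥ x₀.st + star x₀.st ⬝ᵥ x₀.st).re) +
  ((z.W * M).trace - star x₀.v ⬝ᵥ (M *ᵥ z.x.v) - star z.x.v ⬝ᵥ (M *ᵥ x₀.v)
    + star x₀.v ⬝ᵥ (M *ᵥ x₀.v)).re

/-- The lifted cost `h_L`. -/
def liftedCost (o p : G → ℝ) : ℝ := ∑ g, (N.c0 g + N.c1 g * p g + N.c2 g * o g)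

/-- The objective of the penalized relaxation. -/
def relaxedObjective (M : Matrix V V ℂ) (x₀ : OPFPoint V G E) (μ : ℝ)
    (z : LiftedPoint V G E) : ℝ :=
  N.liftedCost z.o z.x.p + μ * penalty M x₀ z

/-- Feasibility for the relaxation with cone `C_k`. -/
structure RelaxedFeasible (k : ConeKind) (z : LiftedPoint V G E) : Prop where
  hermitian : z.W.IsHermitian
  balance_eq : ∀ i, N.balance z.W z.x.s i = 0
  from_eq : ∀ l, N.fromFlow z.W z.x.sf l = 0
  to_eq : ∀ l, N.toFlow z.W z.x.st l = 0
  voltage : ∀ i, N.vmin i ^ 2 ≤ (z.W i i).re ∧ (z.W i i).re ≤ N.vmax i ^ 2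
  activeGen : ∀ g, N.pmin g ≤ z.x.p g ∧ z.x.p g ≤ N.pmax g
  reactiveGen : ∀ g, N.qmin g ≤ z.x.q g ∧ z.x.q g ≤ N.qmax g
  fromLimit : ∀ l, ‖z.x.sf l‖ ^ 2 ≤ z.ff l ∧ z.ff l ≤ N.fmax l ^ 2
  toLimit : ∀ l, ‖z.x.st l‖ ^ 2 ≤ z.ft l ∧ z.ft l ≤ N.fmax l ^ 2
  active_sq : ∀ g, z.x.p g ^ 2 ≤ z.o g
  reactive_sq : ∀ g, z.x.q g ^ 2 ≤ z.r g
  mem_cone : z.W - outer z.x.v ∈ N.cone k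

/-- `z` is a (globally optimal) solution of the penalized relaxation. -/
def IsRelaxedSolution (k : ConeKind) (M : Matrix V V ℂ) (x₀ : OPFPoint V G E) (μ : ℝ)
    (z : LiftedPoint V G E) : Prop :=
  N.RelaxedFeasible k z ∧
    ∀ z', N.RelaxedFeasible k z' → N.relaxedObjective M x₀ μ z ≤ N.relaxedObjective M x₀ μ z'

/-- `z` and `z'` agree in all variables that occur in the relaxation with cone `C_k`, i.e. in
everything except possibly entries of `W` that appear neither in a constraint nor in the
objective.  In the semidefinite case, and whenever every two distinct buses are joined by a line,
this is equality. -/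
def Agree (k : ConeKind) (z z' : LiftedPoint V G E) : Prop :=
  (∀ i j, N.Occurs k i j → z.W i j = z'.W i j) ∧
    z.o = z'.o ∧ z.r = z'.r ∧ z.ff = z'.ff ∧ z.ft = z'.ft ∧ z.x = z'.x

end PowerNetwork

end

/-! Put δ = 1/μ and minimize penalty + δ · cost. By `penalty_eq` the penalty is the slack of the
conic constraints plus a squared distance to `x₀`, both weighted partly by `M`. Since `M` is
interior to the dual cone, these parts dominate ε times `gap` and ε times the squared Euclidean
distance. Hence at δ = 0 the lift of `x₀` is optimal with zero multipliers, and large μ is a small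
perturbation of that case.

All scalar constraints are affine in the lifted variables and use only entries of `W` controlled by
the cone. Replacing `z` by the lift of its point `z.x` therefore changes them by at most a constant
times `gap z` (`exists_abs_liftedConstraint_sub_le`). For multipliers of norm at most some r,
independent of δ, the penalty absorbs this change with ε/2 · `gap z` to spare
(`exists_gap_le_liftedLagrangian`). So lifts are the best lifted points for the Lagrangian. Applied
to a mixture of two lifts, whose gap is exactly a b ‖x - y‖², the same estimate makes the Lagrangian
strongly convex in x, although the power flow equations are not convex.

Sion's theorem then yields a saddle point on a ball around `x₀` times the truncated cone of
correctly signed multipliers (`exists_saddle`). Growth of the penalty keeps x near `x₀`.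
Stationarity and LICQ, which persists near `x₀`, give ‖w‖ < r, so the truncation is not felt.
Maximality in w then enforces the constraints active at `x₀` (`le_of_isMax_signCone`), and
continuity preserves the others. Weak duality makes the lift of x optimal; the spare gap term and
strong convexity give uniqueness. -/

/-! ### Saddle points with small multipliers under a small perturbation -/

section Saddle

variable {X A : Type*} [NormedAddCommGroup X] [NormedSpace ℝ X] [Fintype A]

/-- A linearly independent family of derivatives stays uniformly independent nearby. -/
theorem exists_norm_le_norm_sum_fderiv {g : A → X → ℝ} {x₀ : X}
    (hg : ∀ a, ContDiff ℝ 1 (g a)) (hli : LinearIndependent ℝ fun a => fderiv ℝ (g a) x₀) :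
    ∃ m : ℝ, 0 < m ∧ ∀ᶠ x in nhds x₀, ∀ w : A → ℝ,
      m * ‖w‖ ≤ ‖∑ a, w a • fderiv ℝ (g a) x‖ := by
  classical
  obtain ⟨K, hK0, hK⟩ := (Fintype.linearCombination ℝ
    (fun a => fderiv ℝ (g a) x₀)).exists_antilipschitzWith
      (LinearMap.ker_eq_bot.2 (hli.fintypeLinearCombination_injective))
  have hK' : ∀ w : A → ℝ, ‖w‖ ≤ K * ‖∑ a, w a • fderiv ℝ (g a) x₀‖ := fun w => by
    simpa [Fintype.linearCombination_apply] using hK.le_mul_dist w 0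
  have hKpos : (0 : ℝ) < K := hK0
  -- Derivatives within `e` of those at `x₀` change the combination by at most ‖w‖ / (2K), half of
  -- the lower bound ‖w‖ / K at `x₀`. The `+ 1` covers an empty family.
  set e : ℝ := (2 * K * (Fintype.card A + 1))⁻¹ with he
  have hepos : 0 < e := by positivity
  refine ⟨(2 * K)⁻¹, by positivity, ?_⟩
  have hev : ∀ᶠ x in nhds x₀, ∀ a, ‖fderiv ℝ (g a) x - fderiv ℝ (g a) x₀‖ < e := by
    rw [Filter.eventually_all]
    intro a
    have hc := ((hg a).continuous_fderiv one_ne_zero).tendsto x₀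
    filter_upwards [hc (Metric.ball_mem_nhds _ hepos)] with x hx
    simpa [dist_eq_norm] using hx
  filter_upwards [hev] with x hx w
  have hsplit : ∑ a, w a • fderiv ℝ (g a) x₀ = ∑ a, w a • fderiv ℝ (g a) x -
      ∑ a, w a • (fderiv ℝ (g a) x - fderiv ℝ (g a) x₀) := by
    rw [← Finset.sum_sub_distrib]
    exact Finset.sum_congr rfl fun a _ => by rw [smul_sub]; abel
  have hsmall : ‖∑ a, w a • (fderiv ℝ (g a) x - fderiv ℝ (g a) x₀)‖ ≤
      Fintype.card A * (‖w‖ * e) := by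
    refine (norm_sum_le _ _).trans ?_
    have : ∀ a ∈ Finset.univ, ‖w a • (fderiv ℝ (g a) x - fderiv ℝ (g a) x₀)‖ ≤ ‖w‖ * e :=
      fun a _ => by
        rw [norm_smul]
        exact mul_le_mul (norm_le_pi_norm w a) (hx a).le (norm_nonneg _) (norm_nonneg _)
    simpa using Finset.sum_le_card_nsmul _ _ _ this
  have h1 : ‖∑ a, w a • fderiv ℝ (g a) x₀‖ ≤ ‖∑ a, w a • fderiv ℝ (g a) x‖ +
      Fintype.card A * (‖w‖ * e) := by
    rw [hsplit]
    exact (norm_sub_le _ _).trans (by gcongr)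
  have h2 : (Fintype.card A : ℝ) * (‖w‖ * e) ≤ (2 * K : ℝ)⁻¹ * ‖w‖ := by
    have : (Fintype.card A : ℝ) * e ≤ (2 * K : ℝ)⁻¹ := by
      rw [he, mul_inv, mul_comm, mul_assoc]
      have : ((Fintype.card A : ℝ) + 1)⁻¹ * Fintype.card A ≤ 1 := by
        rw [inv_mul_le_iff₀ (by positivity)]; linarith
      exact mul_le_of_le_one_right (by positivity) this
    calc (Fintype.card A : ℝ) * (‖w‖ * e) = (Fintype.card A * e) * ‖w‖ := by ring
      _ ≤ _ := by gcongr
  have h3 : (K : ℝ)⁻¹ * ‖w‖ ≤ ‖∑ a, w a • fderiv ℝ (g a) x₀‖ := by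
    rw [inv_mul_le_iff₀ hKpos]; exact hK' w
  have h4 : (K : ℝ)⁻¹ * ‖w‖ = (2 * K : ℝ)⁻¹ * ‖w‖ + (2 * K : ℝ)⁻¹ * ‖w‖ := by
    field_simp; norm_num
  linarith

/-- The Lagrangian `φ + δ h + ∑ w_a (g_a - g_a x₀)`. -/
def lagrangian (φ h : X → ℝ) (g : A → X → ℝ) (x₀ : X) (δ : ℝ) (x : X) (w : A → ℝ) : ℝ :=
  φ x + δ * h x + ∑ a, w a * (g a x - g a x₀)

/-- A strongly growing function with minimizer `x₀`, slightly perturbed by `δ h`, has a Lagrangian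
saddle point with small multipliers near `x₀` if the constraints are independent at `x₀`. -/
theorem exists_saddle [FiniteDimensional ℝ X] {φ h : X → ℝ} {g : A → X → ℝ} {x₀ : X}
    (hφ : ContDiff ℝ 1 φ) (hh : ContDiff ℝ 1 h) (hg : ∀ a, ContDiff ℝ 1 (g a))
    {ε : ℝ} (hε : 0 < ε) (hφε : ∀ x, ε * ‖x - x₀‖ ^ 2 ≤ φ x) (hφ₀ : φ x₀ = 0)
    (hli : LinearIndependent ℝ fun a => fderiv ℝ (g a) x₀)
    {S : Set (A → ℝ)} (hSc : IsClosed S) (hSconv : Convex ℝ S) (hS0 : 0 ∈ S)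
    {r : ℝ} (hr : 0 < r)
    (hconv : ∀ δ : ℝ, 0 ≤ δ → ∀ w : A → ℝ, ‖w‖ ≤ r →
      ConvexOn ℝ Set.univ fun x => lagrangian φ h g x₀ δ x w)
    {U : Set X} (hU : U ∈ nhds x₀) :
    ∃ δ₀ : ℝ, 0 < δ₀ ∧ ∀ δ : ℝ, 0 < δ → δ ≤ δ₀ → ∃ x ∈ U, ∃ w ∈ S, ‖w‖ < r ∧
      (∀ y, lagrangian φ h g x₀ δ x w ≤ lagrangian φ h g x₀ δ y w) ∧
      ∀ w' ∈ S, ‖w'‖ ≤ r → ∑ a, w' a * (g a x - g a x₀) ≤ ∑ a, w a * (g a x - g a x₀) := by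
  obtain ⟨m, hm, hev⟩ := exists_norm_le_norm_sum_fderiv hg hli
  have hφmin : IsLocalMin φ x₀ := Filter.Eventually.of_forall fun x => by
    rw [hφ₀]; exact le_trans (by positivity) (hφε x)
  have hφ'0 : fderiv ℝ φ x₀ = 0 := hφmin.fderiv_eq_zero
  have hevφ : ∀ᶠ x in nhds x₀, ‖fderiv ℝ φ x‖ < m * r / 4 := by
    have hc := ((hφ.continuous_fderiv one_ne_zero).norm).tendsto x₀
    rw [hφ'0, norm_zero] at hc
    exact hc.eventually_lt_const (by positivity)
  have hevh : ∀ᶠ x in nhds x₀, ‖fderiv ℝ h x‖ < ‖fderiv ℝ h x₀‖ + 1 :=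
    ((hh.continuous_fderiv one_ne_zero).norm.tendsto x₀).eventually_lt_const (by linarith)
  obtain ⟨ρ', hρ', hball⟩ := Metric.eventually_nhds_iff_ball.1
    ((hev.and hevφ).and (hevh.and hU))
  set ρ : ℝ := ρ' / 2 with hρ
  have hρpos : 0 < ρ := by positivity
  have hin : ∀ x ∈ Metric.closedBall x₀ ρ, x ∈ Metric.ball x₀ ρ' := fun x hx =>
    Metric.closedBall_subset_ball (by rw [hρ]; linarith) hx
  have hcomp : IsCompact (Metric.closedBall x₀ ρ) := isCompact_closedBall _ _
  obtain ⟨B, hB⟩ := hcomp.exists_bound_of_continuousOn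
    (f := fun x => h x₀ - h x) (continuous_const.sub hh.continuous).continuousOn
  have hBnn : 0 ≤ B := (norm_nonneg _).trans (hB x₀ (Metric.mem_closedBall_self hρpos.le))
  set D : ℝ := ‖fderiv ℝ h x₀‖ + 1 with hD
  have hDpos : 0 < D := by positivity
  -- The first bound keeps the saddle point off the boundary of the ball; the second makes the
  -- gradient of `δ h` at most m r / 4, so that the multipliers stay below r.
  refine ⟨min (ε * ρ ^ 2 / (2 * (B + 1))) (m * r / (4 * D)), by positivity, ?_⟩
  intro δ hδ hδle
  have hδ1 : δ * B < ε * ρ ^ 2 := by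
    have h1 : δ * (2 * (B + 1)) ≤ ε * ρ ^ 2 :=
      (le_div_iff₀ (by positivity)).1 (hδle.trans (min_le_left _ _))
    nlinarith
  have hδ2 : δ * D ≤ m * r / 4 := by
    have h1 : δ * (4 * D) ≤ m * r :=
      (le_div_iff₀ (by positivity)).1 (hδle.trans (min_le_right _ _))
    linarith
  have hLdiff : ∀ w : A → ℝ, Differentiable ℝ fun x => lagrangian φ h g x₀ δ x w := by
    intro w
    have h1 := hφ.differentiable one_ne_zero
    have h2 := hh.differentiable one_ne_zero
    have h3 := fun a => (hg a).differentiable one_ne_zero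
    unfold lagrangian
    fun_prop
  have hconc : ∀ x, ConcaveOn ℝ Set.univ fun w : A → ℝ => lagrangian φ h g x₀ δ x w := by
    intro x
    refine ⟨convex_univ, fun w _ w' _ a b _ _ hab => le_of_eq ?_⟩
    simp only [lagrangian, smul_eq_mul, Pi.add_apply, Pi.smul_apply]
    have : ∑ i, (a * w i + b * w' i) * (g i x - g i x₀) =
        a * ∑ i, w i * (g i x - g i x₀) + b * ∑ i, w' i * (g i x - g i x₀) := by
      rw [Finset.mul_sum, Finset.mul_sum, ← Finset.sum_add_distrib]
      exact Finset.sum_congr rfl fun _ _ => by ring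
    rw [this]
    linear_combination (φ x + δ * h x) * hab
  have hwcont : ∀ x, Continuous fun w : A → ℝ => lagrangian φ h g x₀ δ x w := by
    intro x; unfold lagrangian; fun_prop
  -- Truncating the multipliers at norm r gives compactness and stays in the range where the
  -- Lagrangian is convex in x.
  obtain ⟨x, hx, w, ⟨hwS, hwr⟩, hsad⟩ := Sion.exists_isSaddlePointOn'
    (X := Metric.closedBall x₀ ρ) (Y := S ∩ Metric.closedBall 0 r)
    (f := fun x w => lagrangian φ h g x₀ δ x w)
    ⟨x₀, Metric.mem_closedBall_self hρpos.le⟩ hcomp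
    (fun w _ => (hLdiff w).continuous.lowerSemicontinuous.lowerSemicontinuousOn _)
    (fun w hw => ((hconv δ hδ.le w (by simpa using hw.2)).subset (Set.subset_univ _)
      (convex_closedBall _ _)).quasiconvexOn)
    (hSconv.inter (convex_closedBall _ _))
    ((isCompact_closedBall _ _).inter_left hSc)
    (fun x _ => (hwcont x).upperSemicontinuous.upperSemicontinuousOn _)
    (fun x _ => ((hconc x).subset (Set.subset_univ _)
      (hSconv.inter (convex_closedBall _ _))).quasiconcaveOn)
    (convex_closedBall _ _)
    ⟨0, hS0, Metric.mem_closedBall_self hr.le⟩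
  have hwr' : ‖w‖ ≤ r := by simpa using hwr
  -- Compare with the point `x₀`, where all constraint terms vanish, and with the multiplier 0.
  have hkey : φ x + δ * h x ≤ δ * h x₀ := by
    have := hsad x₀ (Metric.mem_closedBall_self hρpos.le) 0
      ⟨hS0, Metric.mem_closedBall_self hr.le⟩
    simpa [lagrangian, hφ₀] using this
  have hxball : x ∈ Metric.ball x₀ ρ := by
    have h1 : h x₀ - h x ≤ B := (le_abs_self _).trans (hB x hx)
    have h2 : ε * ‖x - x₀‖ ^ 2 < ε * ρ ^ 2 := by
      have := hφε x
      nlinarith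
    rw [mem_ball_iff_norm]
    exact lt_of_pow_lt_pow_left₀ 2 hρpos.le (lt_of_mul_lt_mul_left h2 hε.le)
  have hlocmin : IsLocalMin (fun y => lagrangian φ h g x₀ δ y w) x := by
    filter_upwards [Metric.isOpen_ball.mem_nhds hxball] with y hy
    exact hsad y (Metric.ball_subset_closedBall hy) w ⟨hwS, hwr⟩
  have hderiv : fderiv ℝ φ x + δ • fderiv ℝ h x + ∑ a, w a • fderiv ℝ (g a) x = 0 := by
    rw [← hlocmin.fderiv_eq_zero]
    refine (HasFDerivAt.fderiv ?_).symm
    unfold lagrangian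
    refine ((hφ.differentiable one_ne_zero x).hasFDerivAt.add
      ((hh.differentiable one_ne_zero x).hasFDerivAt.const_mul δ)).add
      (HasFDerivAt.fun_sum fun a _ => ?_)
    exact (((hg a).differentiable one_ne_zero x).hasFDerivAt.sub_const _).const_mul _
  obtain ⟨⟨hmx, hφx⟩, hhx, hUx⟩ := hball x (hin x hx)
  refine ⟨x, hUx, w, hwS, ?_, ?_, ?_⟩
  · have h1 : ∑ a, w a • fderiv ℝ (g a) x = -(fderiv ℝ φ x + δ • fderiv ℝ h x) :=
      (neg_eq_of_add_eq_zero_right hderiv).symm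
    have h2 := hmx w
    rw [h1, norm_neg] at h2
    have h3 : ‖fderiv ℝ φ x + δ • fderiv ℝ h x‖ ≤ ‖fderiv ℝ φ x‖ + δ * ‖fderiv ℝ h x‖ := by
      refine (norm_add_le _ _).trans ?_
      rw [norm_smul, Real.norm_of_nonneg hδ.le]
    have h4 : δ * ‖fderiv ℝ h x‖ ≤ δ * D := by gcongr
    -- The gradients of φ and of `δ h` each contribute at most m r / 4.
    have h5 : m * ‖w‖ < m * r := by nlinarith [mul_pos hm hr]
    exact lt_of_mul_lt_mul_left h5 hm.le
  · exact IsMinOn.of_isLocalMin_of_convex_univ hlocmin (hconv δ hδ.le w hwr')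
  · intro w' hw' hw'r
    have := hsad x hx w' ⟨hw', by simpa using hw'r⟩
    simpa [lagrangian] using this

end Saddle

/-! ### Euclidean size of points and Jensen gaps of squares -/

theorem norm_le_sqrt_sum_norm_sq {ι : Type*} [Fintype ι] (f : ι → ℂ) :
    ‖f‖ ≤ √(∑ i, ‖f i‖ ^ 2) :=
  (pi_norm_le_iff_of_nonneg (Real.sqrt_nonneg _)).2 fun i => Real.le_sqrt_of_sq_le <|
    Finset.single_le_sum (f := fun i => ‖f i‖ ^ 2) (fun _ _ => by positivity) (Finset.mem_univ i)

namespace OPFPoint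

variable {V G E : Type*}

@[simp] theorem v_add (x y : OPFPoint V G E) : v (x + y) = v x + v y := rfl
@[simp] theorem s_add (x y : OPFPoint V G E) : s (x + y) = s x + s y := rfl
@[simp] theorem sf_add (x y : OPFPoint V G E) : sf (x + y) = sf x + sf y := rfl
@[simp] theorem st_add (x y : OPFPoint V G E) : st (x + y) = st x + st y := rfl
@[simp] theorem v_sub (x y : OPFPoint V G E) : v (x - y) = v x - v y := rfl
@[simp] theorem s_sub (x y : OPFPoint V G E) : s (x - y) = s x - s y := rfl
@[simp] theorem sf_sub (x y : OPFPoint V G E) : sf (x - y) = sf x - sf y := rfl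
@[simp] theorem st_sub (x y : OPFPoint V G E) : st (x - y) = st x - st y := rfl
@[simp] theorem v_smul (a : ℝ) (x : OPFPoint V G E) : v (a • x) = a • v x := rfl
@[simp] theorem s_smul (a : ℝ) (x : OPFPoint V G E) : s (a • x) = a • s x := rfl
@[simp] theorem sf_smul (a : ℝ) (x : OPFPoint V G E) : sf (a • x) = a • sf x := rfl
@[simp] theorem st_smul (a : ℝ) (x : OPFPoint V G E) : st (a • x) = a • st x := rfl
@[simp] theorem p_add (x y : OPFPoint V G E) : p (x + y) = p x + p y := rfl
@[simp] theorem q_add (x y : OPFPoint V G E) : q (x + y) = q x + q y := rfl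
@[simp] theorem p_smul (a : ℝ) (x : OPFPoint V G E) : p (a • x) = a • p x := by
  ext g; simp [p]
@[simp] theorem q_smul (a : ℝ) (x : OPFPoint V G E) : q (a • x) = a • q x := by
  ext g; simp [q]

variable [Fintype V] [Fintype G] [Fintype E]

/-- Squared Euclidean norm of a point. -/
noncomputable def sqNorm (x : OPFPoint V G E) : ℝ :=
  (∑ k, ‖x.v k‖ ^ 2) + (∑ g, ‖x.s g‖ ^ 2) + (∑ l, ‖x.sf l‖ ^ 2) + ∑ l, ‖x.st l‖ ^ 2

/-- The ambient norm is a supremum norm; this transfers growth bounds found for the Euclidean square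
to the norm used in `exists_saddle`. -/
theorem norm_sq_le_sqNorm (x : OPFPoint V G E) : ‖x‖ ^ 2 ≤ sqNorm x := by
  have h1 : 0 ≤ ∑ k, ‖x.v k‖ ^ 2 := by positivity
  have h2 : 0 ≤ ∑ g, ‖x.s g‖ ^ 2 := by positivity
  have h3 : 0 ≤ ∑ l, ‖x.sf l‖ ^ 2 := by positivity
  have h4 : 0 ≤ ∑ l, ‖x.st l‖ ^ 2 := by positivity
  have h0 : 0 ≤ sqNorm x := by unfold sqNorm; linarith
  have hx : ‖x‖ ≤ √(sqNorm x) := by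
    refine norm_prod_le_iff.2 ⟨?_, norm_prod_le_iff.2 ⟨?_, norm_prod_le_iff.2 ⟨?_, ?_⟩⟩⟩
    · refine (norm_le_sqrt_sum_norm_sq x.v).trans (Real.sqrt_le_sqrt ?_)
      unfold sqNorm; linarith
    · refine (norm_le_sqrt_sum_norm_sq x.s).trans (Real.sqrt_le_sqrt ?_)
      unfold sqNorm; linarith
    · refine (norm_le_sqrt_sum_norm_sq x.sf).trans (Real.sqrt_le_sqrt ?_)
      unfold sqNorm; linarith
    · refine (norm_le_sqrt_sum_norm_sq x.st).trans (Real.sqrt_le_sqrt ?_)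
      unfold sqNorm; linarith
  calc ‖x‖ ^ 2 ≤ √(sqNorm x) ^ 2 := by gcongr
    _ = sqNorm x := Real.sq_sqrt h0

end OPFPoint

theorem outer_apply {V : Type*} (v : V → ℂ) (i j : V) : outer v i j = v i * star (v j) := rfl

theorem outer_isHermitian {V : Type*} (v : V → ℂ) : (outer v).IsHermitian := by
  ext i j
  simp [outer_apply, conjTranspose_apply, mul_comm]

theorem re_outer_self {V : Type*} (v : V → ℂ) (i : V) : (outer v i i).re = ‖v i‖ ^ 2 := by
  rw [outer_apply, ← Complex.normSq_eq_norm_sq]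
  simp [Complex.mul_conj]

/-- `a v v* + b w w* - (a v + b w) (a v + b w)* = a b (v - w) (v - w)*` if `a + b = 1`. -/
theorem mix_outer_sub {V : Type*} {a b : ℝ} (hab : a + b = 1) (v w : V → ℂ) :
    a • outer v + b • outer w - outer (a • v + b • w) = (a * b) • outer (v - w) := by
  obtain rfl : b = 1 - a := by linarith
  ext i j
  simp [outer_apply]
  ring

theorem trace_outer_mul {V : Type*} [Fintype V] (v : V → ℂ) (M : Matrix V V ℂ) :
    (outer v * M).trace = star v ⬝ᵥ (M *ᵥ v) := by
  rw [outer, vecMulVec_mul, trace_vecMulVec, dotProduct_mulVec, dotProduct_comm]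

/-- Jensen gap of the squared modulus. -/
theorem mix_norm_sq_sub {a b : ℝ} (hab : a + b = 1) (u w : ℂ) :
    a * ‖u‖ ^ 2 + b * ‖w‖ ^ 2 - ‖a • u + b • w‖ ^ 2 = a * b * ‖u - w‖ ^ 2 := by
  obtain rfl : b = 1 - a := by linarith
  simp only [← Complex.normSq_eq_norm_sq, Complex.normSq_apply, Complex.add_re, Complex.add_im,
    Complex.sub_re, Complex.sub_im, Complex.real_smul, Complex.re_ofReal_mul,
    Complex.im_ofReal_mul]
  ring

/-! ### Entries of cone members are controlled by the trace -/

namespace PowerNetwork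

variable {V G E : Type*}

section Cones

variable (N : PowerNetwork V G E) {k : ConeKind} {H : Matrix V V ℂ}

theorem Occurs.symm {N : PowerNetwork V G E} {i j : V} (h : N.Occurs k i j) : N.Occurs k j i := by
  cases k
  · trivial
  all_goals
    rcases h with h | ⟨l, h⟩
    · exact Or.inl h.symm
    · exact Or.inr ⟨l, h.symm⟩

theorem occurs_self (k : ConeKind) (i : V) : N.Occurs k i i := by
  cases k
  · trivial
  all_goals exact Or.inl rfl

theorem occurs_line (k : ConeKind) (l : E) : N.Occurs k (N.src l) (N.tgt l) := by
  cases k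
  · trivial
  all_goals exact Or.inr ⟨l, Or.inl ⟨rfl, rfl⟩⟩

theorem cone_isHermitian (hH : H ∈ N.cone k) : H.IsHermitian := by
  cases k
  · exact hH.isHermitian
  all_goals exact hH.1

theorem cone_diag_nonneg (hH : H ∈ N.cone k) (i : V) : 0 ≤ (H i i).re := by
  cases k
  · exact (Complex.le_def.1 (hH.diag_nonneg (i := i))).1
  all_goals exact hH.2.1 i

/-- This is nonnegativity of the determinant of the 2 × 2 submatrix on i, j, where the indices may
coincide. -/
theorem norm_sq_le_of_posSemidef (hH : H.PosSemidef) (i j : V) :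
    ‖H i j‖ ^ 2 ≤ (H i i).re * (H j j).re := by
  have hdet := (hH.submatrix ![i, j]).det_nonneg
  rw [det_fin_two] at hdet
  have hji : H j i = star (H i j) := (hH.isHermitian.apply j i).symm
  have h1 : ∀ i, (H i i).im = 0 := fun i =>
    ((Complex.le_def.1 (hH.diag_nonneg (i := i))).2).symm
  have := (Complex.le_def.1 hdet).1
  simp [hji, h1] at this
  rw [← Complex.normSq_eq_norm_sq, Complex.normSq_apply]
  linarith

theorem norm_le_add_of_sq_le_mul {a b c : ℝ} (ha : 0 ≤ a) (hb : 0 ≤ b) (h : c ^ 2 ≤ a * b) :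
    c ≤ a + b := by
  nlinarith [mul_nonneg ha hb]

theorem cone_norm_line_le (hH : H ∈ N.cone k) {i j : V} (l : E) (hi : N.src l = i)
    (hj : N.tgt l = j) : ‖H i j‖ ≤ (H i i).re + (H j j).re := by
  subst hi hj
  have hd := N.cone_diag_nonneg hH
  cases k
  · exact norm_le_add_of_sq_le_mul (hd _) (hd _) (norm_sq_le_of_posSemidef hH _ _)
  · exact norm_le_add_of_sq_le_mul (hd _) (hd _) (hH.2.2 l)
  · have := hH.2.2 l
    have := Complex.norm_le_abs_re_add_abs_im (H (N.src l) (N.tgt l))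
    linarith

theorem norm_apply_comm (hH : H.IsHermitian) (i j : V) : ‖H i j‖ = ‖H j i‖ := by
  rw [← hH.apply i j, norm_star]

/-- On a cone, the entries that occur are dominated by the diagonal. -/
theorem cone_norm_le (hH : H ∈ N.cone k) {i j : V} (hij : N.Occurs k i j) :
    ‖H i j‖ ≤ (H i i).re + (H j j).re := by
  have hd := N.cone_diag_nonneg hH
  have hherm := N.cone_isHermitian hH
  have key : (i = j ∨ ∃ l, (N.src l = i ∧ N.tgt l = j) ∨ (N.src l = j ∧ N.tgt l = i)) →
      ‖H i j‖ ≤ (H i i).re + (H j j).re := by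
    rintro (rfl | ⟨l, ⟨h1, h2⟩ | ⟨h1, h2⟩⟩)
    · have him : (H i i).im = 0 := by
        have := congrArg Complex.im (hherm.apply i i)
        simp at this; linarith
      have := Complex.norm_le_abs_re_add_abs_im (H i i)
      rw [him, abs_zero, abs_of_nonneg (hd i)] at this
      linarith [hd i]
    · exact N.cone_norm_line_le hH l h1 h2
    · rw [norm_apply_comm hherm, add_comm]
      exact N.cone_norm_line_le hH l h1 h2
  cases k
  · exact norm_le_add_of_sq_le_mul (hd _) (hd _) (norm_sq_le_of_posSemidef hH _ _)
  · exact key hij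
  · exact key hij

variable [Fintype V]

theorem cone_diag_le_trace (hH : H ∈ N.cone k) (i : V) : (H i i).re ≤ H.trace.re := by
  rw [trace, Complex.re_sum]
  exact Finset.single_le_sum (f := fun i => (H i i).re) (fun i _ => N.cone_diag_nonneg hH i)
    (Finset.mem_univ i)

theorem cone_trace_nonneg (hH : H ∈ N.cone k) : 0 ≤ H.trace.re := by
  rw [trace, Complex.re_sum]
  exact Finset.sum_nonneg fun i _ => N.cone_diag_nonneg hH i

theorem cone_norm_le_trace (hH : H ∈ N.cone k) {i j : V} (hij : N.Occurs k i j) :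
    ‖H i j‖ ≤ 2 * H.trace.re := by
  linarith [N.cone_norm_le hH hij, N.cone_diag_le_trace hH i, N.cone_diag_le_trace hH j]

theorem outer_mem_cone (k : ConeKind) (v : V → ℂ) : outer v ∈ N.cone k := by
  have hd : ∀ i, 0 ≤ (outer v i i).re := fun i => by rw [re_outer_self]; positivity
  have hn : ∀ i j, ‖outer v i j‖ = ‖v i‖ * ‖v j‖ := fun i j => by simp [outer_apply]
  cases k
  · exact posSemidef_vecMulVec_self_star v
  · refine ⟨outer_isHermitian v, hd, fun l => ?_⟩
    rw [hn, re_outer_self, re_outer_self, mul_pow]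
  · refine ⟨outer_isHermitian v, hd, fun l => ?_⟩
    have h1 := Complex.abs_re_le_norm (outer v (N.src l) (N.tgt l))
    have h2 := Complex.abs_im_le_norm (outer v (N.src l) (N.tgt l))
    rw [hn] at h1 h2
    rw [re_outer_self, re_outer_self]
    constructor <;> nlinarith [sq_nonneg (‖v (N.src l)‖ - ‖v (N.tgt l)‖)]

/-- By `mix_outer_sub`, the slack matrix of a mixture of two lifts has this form. -/
theorem smul_outer_mem_cone (k : ConeKind) {a : ℝ} (ha : 0 ≤ a) (v : V → ℂ) :
    a • outer v ∈ N.cone k := by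
  have : a • outer v = outer ((√a) • v) := by
    have hs : ((√a : ℝ) : ℂ) * ((√a : ℝ) : ℂ) = a := by
      rw [← Complex.ofReal_mul, Real.mul_self_sqrt ha]
    ext i j
    simp only [outer_apply, Matrix.smul_apply, Pi.smul_apply, Complex.real_smul, star_mul',
      Complex.star_def, Complex.conj_ofReal]
    linear_combination (-(v i * (starRingEnd ℂ) (v j))) * hs
  rw [this]
  exact N.outer_mem_cone k _

/-- A linear functional of a row whose coefficients sit at occurring entries is dominated by the
trace. -/
theorem exists_norm_row_le (k : ConeKind) (i : V) (y : V → ℂ)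
    (hy : ∀ j, y j ≠ 0 → N.Occurs k i j) :
    ∃ C : ℝ, 0 ≤ C ∧ ∀ H ∈ N.cone k, ‖∑ j, H i j * star (y j)‖ ≤ C * H.trace.re := by
  refine ⟨∑ j, 2 * ‖y j‖, by positivity, fun H hH => (norm_sum_le _ _).trans ?_⟩
  rw [Finset.sum_mul]
  refine Finset.sum_le_sum fun j _ => ?_
  rw [norm_mul, norm_star]
  by_cases h : y j = 0
  · simp [h]
  · nlinarith [N.cone_norm_le_trace hH (hy j h), norm_nonneg (y j)]

end Cones

/-! ### Sparsity of the admittance matrices -/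

section Rows

variable [DecidableEq V] (N : PowerNetwork V G E)

theorem occurs_of_Yfrom_ne_zero (k : ConeKind) {l : E} {j : V} (h : N.Yfrom l j ≠ 0) :
    N.Occurs k (N.src l) j ∧ N.Occurs k (N.tgt l) j := by
  have : N.src l = j ∨ N.tgt l = j := by
    by_contra! hc
    exact h (by simp [Yfrom, Cfrom, Cto, hc.1, hc.2])
  rcases this with rfl | rfl
  · exact ⟨N.occurs_self k _, (N.occurs_line k l).symm⟩
  · exact ⟨N.occurs_line k l, N.occurs_self k _⟩

theorem occurs_of_Yto_ne_zero (k : ConeKind) {l : E} {j : V} (h : N.Yto l j ≠ 0) :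
    N.Occurs k (N.src l) j ∧ N.Occurs k (N.tgt l) j := by
  have : N.src l = j ∨ N.tgt l = j := by
    by_contra! hc
    exact h (by simp [Yto, Cfrom, Cto, hc.1, hc.2])
  rcases this with rfl | rfl
  · exact ⟨N.occurs_self k _, (N.occurs_line k l).symm⟩
  · exact ⟨N.occurs_line k l, N.occurs_self k _⟩

/-- A shunt contributes only to the diagonal, and a line only to pairs of its own end buses. -/
theorem occurs_of_Ybus_ne_zero [Fintype E] (k : ConeKind) {i j : V} (h : N.Ybus i j ≠ 0) :
    N.Occurs k i j := by
  by_contra hij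
  apply h
  have hne : i ≠ j := by rintro rfl; exact hij (N.occurs_self k i)
  have h1 : (N.Cfromᵀ * N.Yfrom) i j = 0 := by
    rw [mul_apply]
    refine Finset.sum_eq_zero fun l _ => ?_
    by_cases hl : N.src l = i
    · have : N.Yfrom l j = 0 := by
        by_contra hc
        exact hij (hl ▸ (N.occurs_of_Yfrom_ne_zero k hc).1)
      rw [this, mul_zero]
    · simp [Cfrom, hl]
  have h2 : (N.Ctoᵀ * N.Yto) i j = 0 := by
    rw [mul_apply]
    refine Finset.sum_eq_zero fun l _ => ?_
    by_cases hl : N.tgt l = i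
    · have : N.Yto l j = 0 := by
        by_contra hc
        exact hij (hl ▸ (N.occurs_of_Yto_ne_zero k hc).2)
      rw [this, mul_zero]
    · simp [Cto, hl]
  simp [Ybus, h1, h2, diagonal_apply_ne _ hne]

variable [Fintype V]

theorem Cfrom_mul_mul_apply (W : Matrix V V ℂ) (Y : Matrix E V ℂ) (l : E) :
    (N.Cfrom * W * Yᴴ) l l = ∑ j, W (N.src l) j * star (Y l j) := by
  simp [mul_apply, Cfrom]

theorem Cto_mul_mul_apply (W : Matrix V V ℂ) (Y : Matrix E V ℂ) (l : E) :
    (N.Cto * W * Yᴴ) l l = ∑ j, W (N.tgt l) j * star (Y l j) := by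
  simp [mul_apply, Cto]

end Rows

end PowerNetwork

/-- Makes the space of multipliers finite-dimensional. A label is coded by its constructor and its
index. -/
instance {V G E : Type*} [Finite V] [Finite G] [Finite E] : Finite (ConstraintLabel V G E) := by
  let f : ConstraintLabel V G E → Fin 11 × (V ⊕ G ⊕ E)
    | .balanceRe k => (0, .inl k)
    | .balanceIm k => (1, .inl k)
    | .fromRe l => (2, .inr (.inr l))
    | .fromIm l => (3, .inr (.inr l))
    | .toRe l => (4, .inr (.inr l))
    | .toIm l => (5, .inr (.inr l))
    | .voltage k => (6, .inl k)
    | .activeGen g => (7, .inr (.inl g))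
    | .reactiveGen g => (8, .inr (.inl g))
    | .fromLimit l => (9, .inr (.inr l))
    | .toLimit l => (10, .inr (.inr l))
  refine Finite.of_injective f fun c c' h => ?_
  cases c <;> cases c' <;> simp_all [f]

/-! ### Lifts, mixtures of lifts and slack of the conic constraints -/

namespace PowerNetwork

variable {V G E : Type*}

/-- The point of the relaxation that represents a point of the power flow problem. -/
noncomputable def lift (x : OPFPoint V G E) : LiftedPoint V G E where
  W := outer x.v
  o g := x.p g ^ 2
  r g := x.q g ^ 2
  ff l := ‖x.sf l‖ ^ 2
  ft l := ‖x.st l‖ ^ 2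
  x := x

/-- The combination of the lifts of two points with weights `a` and `b`. -/
noncomputable def mixLift (a b : ℝ) (x y : OPFPoint V G E) : LiftedPoint V G E where
  W := a • outer x.v + b • outer y.v
  o g := a * x.p g ^ 2 + b * y.p g ^ 2
  r g := a * x.q g ^ 2 + b * y.q g ^ 2
  ff l := a * ‖x.sf l‖ ^ 2 + b * ‖y.sf l‖ ^ 2
  ft l := a * ‖x.st l‖ ^ 2 + b * ‖y.st l‖ ^ 2
  x := a • x + b • y

section Conic

theorem norm_sq_s (x : OPFPoint V G E) (g : G) : ‖x.s g‖ ^ 2 = x.p g ^ 2 + x.q g ^ 2 := by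
  rw [← Complex.normSq_eq_norm_sq, Complex.normSq_apply, OPFPoint.p, OPFPoint.q]
  ring

variable [Fintype V] (N : PowerNetwork V G E) {k : ConeKind}

/-- The convex constraints by which the relaxation replaces the products of variables. -/
structure Conic (k : ConeKind) (z : LiftedPoint V G E) : Prop where
  mem_cone : z.W - outer z.x.v ∈ N.cone k
  active_sq : ∀ g, z.x.p g ^ 2 ≤ z.o g
  reactive_sq : ∀ g, z.x.q g ^ 2 ≤ z.r g
  from_sq : ∀ l, ‖z.x.sf l‖ ^ 2 ≤ z.ff l
  to_sq : ∀ l, ‖z.x.st l‖ ^ 2 ≤ z.ft l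

theorem conic_lift (k : ConeKind) (x : OPFPoint V G E) : N.Conic k (lift x) where
  mem_cone := by
    have := N.smul_outer_mem_cone k le_rfl (0 : V → ℂ)
    rw [zero_smul] at this
    rwa [lift, sub_self]
  active_sq _ := le_rfl
  reactive_sq _ := le_rfl
  from_sq _ := le_rfl
  to_sq _ := le_rfl

theorem mix_sq_sub {a b : ℝ} (hab : a + b = 1) (s t : ℝ) :
    a * s ^ 2 + b * t ^ 2 - (a * s + b * t) ^ 2 = a * b * (s - t) ^ 2 := by
  obtain rfl : b = 1 - a := by linarith
  ring

/-- Every slack of a mixture is a Jensen gap: a b times a square, or times a rank-one matrix. -/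
theorem conic_mixLift (k : ConeKind) {a b : ℝ} (ha : 0 ≤ a) (hb : 0 ≤ b) (hab : a + b = 1)
    (x y : OPFPoint V G E) : N.Conic k (mixLift a b x y) where
  mem_cone := by
    simp only [mixLift, OPFPoint.v_add, OPFPoint.v_smul, mix_outer_sub hab]
    exact N.smul_outer_mem_cone k (mul_nonneg ha hb) _
  active_sq g := by
    simp only [mixLift, OPFPoint.p_add, OPFPoint.p_smul, Pi.add_apply, Pi.smul_apply, smul_eq_mul]
    have := mix_sq_sub hab (x.p g) (y.p g)
    have : 0 ≤ a * b * (x.p g - y.p g) ^ 2 := by positivity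
    linarith
  reactive_sq g := by
    simp only [mixLift, OPFPoint.q_add, OPFPoint.q_smul, Pi.add_apply, Pi.smul_apply, smul_eq_mul]
    have := mix_sq_sub hab (x.q g) (y.q g)
    have : 0 ≤ a * b * (x.q g - y.q g) ^ 2 := by positivity
    linarith
  from_sq l := by
    simp only [mixLift, OPFPoint.sf_add, OPFPoint.sf_smul, Pi.add_apply, Pi.smul_apply]
    have := mix_norm_sq_sub hab (x.sf l) (y.sf l)
    have : 0 ≤ a * b * ‖x.sf l - y.sf l‖ ^ 2 := by positivity
    linarith
  to_sq l := by
    simp only [mixLift, OPFPoint.st_add, OPFPoint.st_smul, Pi.add_apply, Pi.smul_apply]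
    have := mix_norm_sq_sub hab (x.st l) (y.st l)
    have : 0 ≤ a * b * ‖x.st l - y.st l‖ ^ 2 := by positivity
    linarith

variable [Fintype G] [Fintype E]

/-- Total slack of the conic constraints. -/
noncomputable def gap (z : LiftedPoint V G E) : ℝ :=
  (z.W - outer z.x.v).trace.re + (∑ g, (z.o g - z.x.p g ^ 2)) + (∑ g, (z.r g - z.x.q g ^ 2)) +
    (∑ l, (z.ff l - ‖z.x.sf l‖ ^ 2)) + ∑ l, (z.ft l - ‖z.x.st l‖ ^ 2)

variable {N} {z : LiftedPoint V G E}

theorem Conic.summands_nonneg (hz : N.Conic k z) :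
    0 ≤ (z.W - outer z.x.v).trace.re ∧ 0 ≤ ∑ g, (z.o g - z.x.p g ^ 2) ∧
    0 ≤ ∑ g, (z.r g - z.x.q g ^ 2) ∧ 0 ≤ ∑ l, (z.ff l - ‖z.x.sf l‖ ^ 2) ∧
    0 ≤ ∑ l, (z.ft l - ‖z.x.st l‖ ^ 2) :=
  ⟨N.cone_trace_nonneg hz.mem_cone,
    Finset.sum_nonneg fun g _ => sub_nonneg.2 (hz.active_sq g),
    Finset.sum_nonneg fun g _ => sub_nonneg.2 (hz.reactive_sq g),
    Finset.sum_nonneg fun l _ => sub_nonneg.2 (hz.from_sq l),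
    Finset.sum_nonneg fun l _ => sub_nonneg.2 (hz.to_sq l)⟩

theorem Conic.gap_nonneg (hz : N.Conic k z) : 0 ≤ gap z := by
  obtain ⟨h1, h2, h3, h4, h5⟩ := hz.summands_nonneg
  unfold gap; linarith

theorem Conic.trace_le_gap (hz : N.Conic k z) : (z.W - outer z.x.v).trace.re ≤ gap z := by
  obtain ⟨h1, h2, h3, h4, h5⟩ := hz.summands_nonneg
  unfold gap; linarith

theorem Conic.from_le_gap (hz : N.Conic k z) (l : E) : z.ff l - ‖z.x.sf l‖ ^ 2 ≤ gap z := by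
  obtain ⟨h1, h2, h3, h4, h5⟩ := hz.summands_nonneg
  have := Finset.single_le_sum (f := fun l => z.ff l - ‖z.x.sf l‖ ^ 2)
    (fun l _ => sub_nonneg.2 (hz.from_sq l)) (Finset.mem_univ l)
  unfold gap; linarith

theorem Conic.to_le_gap (hz : N.Conic k z) (l : E) : z.ft l - ‖z.x.st l‖ ^ 2 ≤ gap z := by
  obtain ⟨h1, h2, h3, h4, h5⟩ := hz.summands_nonneg
  have := Finset.single_le_sum (f := fun l => z.ft l - ‖z.x.st l‖ ^ 2)
    (fun l _ => sub_nonneg.2 (hz.to_sq l)) (Finset.mem_univ l)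
  unfold gap; linarith

/-- Without slack, a lifted point is a lift up to entries that do not occur. -/
theorem Conic.agree_lift (hz : N.Conic k z) (h : gap z ≤ 0) : N.Agree k z (lift z.x) := by
  obtain ⟨h1, h2, h3, h4, h5⟩ := hz.summands_nonneg
  unfold gap at h
  have key : ∀ {f g : G → ℝ}, (∀ i, f i ≤ g i) → ∑ i, (g i - f i) ≤ 0 → g = f := by
    intro f g hfg hs
    have h0 : ∑ i, (g i - f i) = 0 :=
      le_antisymm hs (Finset.sum_nonneg fun i _ => sub_nonneg.2 (hfg i))
    have := (Finset.sum_eq_zero_iff_of_nonneg fun i _ => sub_nonneg.2 (hfg i)).1 h0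
    funext i
    exact sub_eq_zero.1 (this i (Finset.mem_univ i))
  refine ⟨fun i j hij => ?_, key hz.active_sq (by simp only [lift]; linarith only [h, h1, h2, h3, h4, h5]),
    key hz.reactive_sq (by simp only [lift]; linarith only [h, h1, h2, h3, h4, h5]), ?_, ?_, rfl⟩
  -- The trace of the slack matrix is one of the nonnegative summands of the gap, and it dominates
  -- each occurring entry.
  · have := N.cone_norm_le_trace hz.mem_cone hij
    have h0 : ‖(z.W - outer z.x.v) i j‖ ≤ 0 := by linarith
    exact sub_eq_zero.1 (norm_le_zero_iff.1 h0)
  · funext l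
    have := hz.from_le_gap l; have := hz.from_sq l
    unfold gap at *; simp only [lift]; linarith
  · funext l
    have := hz.to_le_gap l; have := hz.to_sq l
    unfold gap at *; simp only [lift]; linarith

/-- The source of strong convexity: a bound linear in the gap becomes quadratic in x - y. -/
theorem gap_mixLift {a b : ℝ} (hab : a + b = 1) (x y : OPFPoint V G E) :
    gap (mixLift a b x y) = a * b * OPFPoint.sqNorm (x - y) := by
  have ht : (outer (x.v - y.v)).trace.re = ∑ i, ‖x.v i - y.v i‖ ^ 2 := by
    rw [trace, Complex.re_sum]
    exact Finset.sum_congr rfl fun i _ => re_outer_self _ _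
  simp only [gap, mixLift, OPFPoint.v_add, OPFPoint.v_smul, mix_outer_sub hab, OPFPoint.p_add,
    OPFPoint.p_smul, OPFPoint.q_add, OPFPoint.q_smul, OPFPoint.sf_add, OPFPoint.sf_smul,
    OPFPoint.st_add, OPFPoint.st_smul, Pi.add_apply, Pi.smul_apply, smul_eq_mul,
    mix_sq_sub hab, mix_norm_sq_sub hab, ← Finset.mul_sum, trace_smul, Complex.smul_re, ht,
    OPFPoint.sqNorm, norm_sq_s, OPFPoint.v_sub, OPFPoint.sf_sub, OPFPoint.st_sub,
    Pi.sub_apply, Finset.sum_add_distrib]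
  simp only [OPFPoint.p, OPFPoint.q, OPFPoint.s_sub, Pi.sub_apply, Complex.sub_re, Complex.sub_im]
  ring

end Conic

/-- Interior points of the dual cone dominate a positive multiple of the trace. -/
theorem exists_mul_trace_le [Fintype V] [DecidableEq V] {N : PowerNetwork V G E}
    {k : ConeKind} {M : Matrix V V ℂ} (hM : M ∈ N.dualInterior k) :
    ∃ ε : ℝ, 0 < ε ∧ ε ≤ 1 ∧ ∀ H ∈ N.cone k, ε * H.trace.re ≤ (H * M).trace.re := by
  obtain ⟨-, ε, hε, -, h⟩ := hM
  -- The cap at 1 lets the same constant serve the slack and distance terms that enter the penalty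
  -- with weight 1.
  refine ⟨min ε 1, by positivity, min_le_right _ _, fun H hH => ?_⟩
  have h1 := h H hH
  rw [mul_sub, trace_sub, Matrix.mul_smul, mul_one, trace_smul, Complex.sub_re, smul_eq_mul,
    Complex.re_ofReal_mul] at h1
  nlinarith [N.cone_trace_nonneg hH, min_le_left ε 1]

/-! ### The penalty as slack plus distance -/

section Penalty

variable [Fintype V] [Fintype G] [Fintype E] {M : Matrix V V ℂ} {x₀ : OPFPoint V G E}

/-- The penalty is the weighted slack of the conic constraints plus a weighted squared distance. -/
theorem penalty_eq (M : Matrix V V ℂ) (x₀ : OPFPoint V G E) (z : LiftedPoint V G E) :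
    penalty M x₀ z =
      (((z.W - outer z.x.v) * M).trace.re + (∑ g, (z.o g - z.x.p g ^ 2)) +
        (∑ g, (z.r g - z.x.q g ^ 2)) + (∑ l, (z.ff l - ‖z.x.sf l‖ ^ 2)) +
        ∑ l, (z.ft l - ‖z.x.st l‖ ^ 2)) +
      ((outer (z.x.v - x₀.v) * M).trace.re + (∑ g, ‖z.x.s g - x₀.s g‖ ^ 2) +
        (∑ l, ‖z.x.sf l - x₀.sf l‖ ^ 2) + ∑ l, ‖z.x.st l - x₀.st l‖ ^ 2) := by
  have hflow : ∀ (f : E → ℝ) (s t : E → ℂ),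
      (∑ l, f l) + (-(star s ⬝ᵥ t) - star t ⬝ᵥ s + star s ⬝ᵥ s).re =
        (∑ l, (f l - ‖t l‖ ^ 2)) + ∑ l, ‖t l - s l‖ ^ 2 := by
    intro f s t
    simp only [dotProduct, Complex.add_re, Complex.sub_re, Complex.neg_re, Complex.re_sum,
      ← Finset.sum_add_distrib, ← Finset.sum_sub_distrib, ← Finset.sum_neg_distrib]
    refine Finset.sum_congr rfl fun l _ => ?_
    simp only [← Complex.normSq_eq_norm_sq, Complex.normSq_apply, Pi.star_apply, Complex.star_def,
      Complex.mul_re, Complex.conj_re, Complex.conj_im, Complex.sub_re, Complex.sub_im]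
    ring
  have hgen : ∀ (o s t : G → ℝ), (∑ g, o g) - 2 * (s ⬝ᵥ t) + s ⬝ᵥ s =
      (∑ g, (o g - t g ^ 2)) + ∑ g, (t g - s g) ^ 2 := by
    intro o s t
    simp only [dotProduct, Finset.mul_sum, ← Finset.sum_add_distrib, ← Finset.sum_sub_distrib]
    exact Finset.sum_congr rfl fun g _ => by ring
  have hs : ∑ g, ‖z.x.s g - x₀.s g‖ ^ 2 =
      (∑ g, (z.x.p g - x₀.p g) ^ 2) + ∑ g, (z.x.q g - x₀.q g) ^ 2 := by
    rw [← Finset.sum_add_distrib]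
    refine Finset.sum_congr rfl fun g _ => ?_
    exact norm_sq_s (z.x - x₀) g
  have hv : (z.W * M).trace - star x₀.v ⬝ᵥ (M *ᵥ z.x.v) - star z.x.v ⬝ᵥ (M *ᵥ x₀.v)
      + star x₀.v ⬝ᵥ (M *ᵥ x₀.v) =
      ((z.W - outer z.x.v) * M).trace + (outer (z.x.v - x₀.v) * M).trace := by
    rw [sub_mul, trace_sub, trace_outer_mul, trace_outer_mul, star_sub, mulVec_sub,
      sub_dotProduct, dotProduct_sub, dotProduct_sub]
    ring
  rw [penalty, hflow, hflow, hgen, hgen, hs, hv, Complex.add_re]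
  ring

theorem penalty_lift_self (M : Matrix V V ℂ) (x₀ : OPFPoint V G E) :
    penalty M x₀ (lift x₀) = 0 := by
  rw [penalty_eq]
  have : outer (0 : V → ℂ) = 0 := by ext i j; simp [outer_apply]
  simp [lift, this]

variable {N : PowerNetwork V G E} {k : ConeKind} {ε : ℝ}

/-- Both points have the same `x`, so the distance terms cancel, and the lift has no slack. -/
theorem mul_gap_le_penalty_sub (hε1 : ε ≤ 1)
    (hM : ∀ H ∈ N.cone k, ε * H.trace.re ≤ (H * M).trace.re) {z : LiftedPoint V G E}
    (hz : N.Conic k z) : ε * gap z ≤ penalty M x₀ z - penalty M x₀ (lift z.x) := by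
  obtain ⟨h1, h2, h3, h4, h5⟩ := hz.summands_nonneg
  have h := hM _ hz.mem_cone
  rw [penalty_eq, penalty_eq]
  simp only [gap, lift, sub_self, zero_mul, trace_zero, Complex.zero_re, Finset.sum_const_zero]
  nlinarith

/-- A lift has no slack, and the voltage part of the distance pairs `M` with a rank-one member of
the cone. -/
theorem mul_sqNorm_le_penalty_lift (hε1 : ε ≤ 1)
    (hM : ∀ H ∈ N.cone k, ε * H.trace.re ≤ (H * M).trace.re) (x : OPFPoint V G E) :
    ε * OPFPoint.sqNorm (x - x₀) ≤ penalty M x₀ (lift x) := by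
  have h := hM _ (N.outer_mem_cone k (x.v - x₀.v))
  have ht : (outer (x.v - x₀.v)).trace.re = ∑ i, ‖x.v i - x₀.v i‖ ^ 2 := by
    rw [trace, Complex.re_sum]
    exact Finset.sum_congr rfl fun i _ => re_outer_self _ _
  have h2 : 0 ≤ ∑ g, ‖x.s g - x₀.s g‖ ^ 2 := by positivity
  have h3 : 0 ≤ ∑ l, ‖x.sf l - x₀.sf l‖ ^ 2 := by positivity
  have h4 : 0 ≤ ∑ l, ‖x.st l - x₀.st l‖ ^ 2 := by positivity
  rw [ht] at h
  rw [penalty_eq]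
  simp only [lift, sub_self, zero_mul, trace_zero, Complex.zero_re, Finset.sum_const_zero,
    OPFPoint.sqNorm, OPFPoint.v_sub, OPFPoint.s_sub, OPFPoint.sf_sub, OPFPoint.st_sub,
    Pi.sub_apply]
  nlinarith

theorem penalty_mixLift {a b : ℝ} (hab : a + b = 1) (x y : OPFPoint V G E) :
    penalty M x₀ (mixLift a b x y) = a * penalty M x₀ (lift x) + b * penalty M x₀ (lift y) := by
  obtain rfl : b = 1 - a := by linarith
  simp only [penalty, mixLift, lift, OPFPoint.v_add, OPFPoint.v_smul, OPFPoint.p_add,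
    OPFPoint.p_smul, OPFPoint.q_add, OPFPoint.q_smul, OPFPoint.sf_add, OPFPoint.sf_smul,
    OPFPoint.st_add, OPFPoint.st_smul, dotProduct_add, dotProduct_smul, add_dotProduct,
    smul_dotProduct, star_add, star_smul, star_trivial, mulVec_add, mulVec_smul, add_mul,
    smul_mul, trace_add, trace_smul, Finset.sum_add_distrib, ← Finset.mul_sum, smul_eq_mul,
    Complex.add_re, Complex.sub_re, Complex.neg_re, Complex.smul_re]
  ring

end Penalty

end PowerNetwork

/-! ### Cost and scalar constraints in the lifted variables -/

namespace PowerNetwork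

section Cost

variable {V G E : Type*} [Fintype G] (N : PowerNetwork V G E)

theorem liftedCost_mixLift {a b : ℝ} (hab : a + b = 1) (x y : OPFPoint V G E) :
    N.liftedCost (mixLift a b x y).o (mixLift a b x y).x.p =
      a * N.cost x.p + b * N.cost y.p := by
  simp only [liftedCost, cost, mixLift, OPFPoint.p_add, OPFPoint.p_smul, Pi.add_apply,
    Pi.smul_apply, smul_eq_mul, Finset.mul_sum, ← Finset.sum_add_distrib]
  refine Finset.sum_congr rfl fun g _ => ?_
  linear_combination -N.c0 g * hab

theorem cost_le_liftedCost [Fintype V] {k : ConeKind} {z : LiftedPoint V G E} (hz : N.Conic k z) :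
    N.cost z.x.p ≤ N.liftedCost z.o z.x.p :=
  Finset.sum_le_sum fun g _ => by nlinarith [hz.active_sq g, N.c2_nonneg g]

end Cost

variable {V G E : Type*} [Fintype V] [DecidableEq V] [Fintype G] [Fintype E]
variable (N : PowerNetwork V G E) {k : ConeKind}

/-- The affine function of the lifted variables that represents a scalar constraint. -/
noncomputable def liftedConstraint : ConstraintLabel V G E → LiftedPoint V G E → ℝ
  | .balanceRe k, z => (N.balance z.W z.x.s k).re
  | .balanceIm k, z => (N.balance z.W z.x.s k).im
  | .fromRe l, z => (N.fromFlow z.W z.x.sf l).re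
  | .fromIm l, z => (N.fromFlow z.W z.x.sf l).im
  | .toRe l, z => (N.toFlow z.W z.x.st l).re
  | .toIm l, z => (N.toFlow z.W z.x.st l).im
  | .voltage k, z => (z.W k k).re
  | .activeGen g, z => z.x.p g
  | .reactiveGen g, z => z.x.q g
  | .fromLimit l, z => z.ff l
  | .toLimit l, z => z.ft l

/-- Lower bounds of the scalar constraints; `-1` is never attained by a squared modulus. -/
noncomputable def lowerBound : ConstraintLabel V G E → ℝ
  | .voltage k => N.vmin k ^ 2
  | .activeGen g => N.pmin g
  | .reactiveGen g => N.qmin g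
  | .fromLimit _ => -1
  | .toLimit _ => -1
  | _ => 0

/-- Upper bounds of the scalar constraints. -/
noncomputable def upperBound : ConstraintLabel V G E → ℝ
  | .voltage k => N.vmax k ^ 2
  | .activeGen g => N.pmax g
  | .reactiveGen g => N.qmax g
  | .fromLimit l => N.fmax l ^ 2
  | .toLimit l => N.fmax l ^ 2
  | _ => 0

theorem liftedConstraint_lift (c : ConstraintLabel V G E) (x : OPFPoint V G E) :
    N.liftedConstraint c (lift x) = N.constraintFun c x := by
  cases c <;> first | rfl | exact re_outer_self _ _

/-- Equations are two-sided bounds with both ends 0, so that one multiplier argument treats all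
constraints. -/
theorem opfFeasible_iff {x : OPFPoint V G E} : N.OPFFeasible x ↔
    ∀ c, N.lowerBound c ≤ N.constraintFun c x ∧ N.constraintFun c x ≤ N.upperBound c := by
  constructor
  · intro h c
    cases c with
    | balanceRe i => simp [lowerBound, upperBound, constraintFun, h.balance_eq]
    | balanceIm i => simp [lowerBound, upperBound, constraintFun, h.balance_eq]
    | fromRe l => simp [lowerBound, upperBound, constraintFun, h.from_eq]
    | fromIm l => simp [lowerBound, upperBound, constraintFun, h.from_eq]
    | toRe l => simp [lowerBound, upperBound, constraintFun, h.to_eq]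
    | toIm l => simp [lowerBound, upperBound, constraintFun, h.to_eq]
    | voltage i => exact h.voltage i
    | activeGen g => exact h.activeGen g
    | reactiveGen g => exact h.reactiveGen g
    | fromLimit l =>
      exact ⟨by simp only [lowerBound, constraintFun]; nlinarith [norm_nonneg (x.sf l)],
        h.fromLimit l⟩
    | toLimit l =>
      exact ⟨by simp only [lowerBound, constraintFun]; nlinarith [norm_nonneg (x.st l)],
        h.toLimit l⟩
  · intro h
    exact
      { balance_eq := fun i => Complex.ext (le_antisymm (h (.balanceRe i)).2 (h (.balanceRe i)).1)
          (le_antisymm (h (.balanceIm i)).2 (h (.balanceIm i)).1)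
        from_eq := fun l => Complex.ext (le_antisymm (h (.fromRe l)).2 (h (.fromRe l)).1)
          (le_antisymm (h (.fromIm l)).2 (h (.fromIm l)).1)
        to_eq := fun l => Complex.ext (le_antisymm (h (.toRe l)).2 (h (.toRe l)).1)
          (le_antisymm (h (.toIm l)).2 (h (.toIm l)).1)
        voltage := fun i => h (.voltage i)
        activeGen := fun g => h (.activeGen g)
        reactiveGen := fun g => h (.reactiveGen g)
        fromLimit := fun l => (h (.fromLimit l)).2
        toLimit := fun l => (h (.toLimit l)).2 }

variable {N}

theorem RelaxedFeasible.conic {z : LiftedPoint V G E} (h : N.RelaxedFeasible k z) :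
    N.Conic k z :=
  ⟨h.mem_cone, h.active_sq, h.reactive_sq, fun l => (h.fromLimit l).1, fun l => (h.toLimit l).1⟩

theorem RelaxedFeasible.bounds {z : LiftedPoint V G E} (h : N.RelaxedFeasible k z)
    (c : ConstraintLabel V G E) :
    N.lowerBound c ≤ N.liftedConstraint c z ∧ N.liftedConstraint c z ≤ N.upperBound c := by
  cases c with
  | balanceRe i => simp [lowerBound, upperBound, liftedConstraint, h.balance_eq]
  | balanceIm i => simp [lowerBound, upperBound, liftedConstraint, h.balance_eq]
  | fromRe l => simp [lowerBound, upperBound, liftedConstraint, h.from_eq]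
  | fromIm l => simp [lowerBound, upperBound, liftedConstraint, h.from_eq]
  | toRe l => simp [lowerBound, upperBound, liftedConstraint, h.to_eq]
  | toIm l => simp [lowerBound, upperBound, liftedConstraint, h.to_eq]
  | voltage i => exact h.voltage i
  | activeGen g => exact h.activeGen g
  | reactiveGen g => exact h.reactiveGen g
  | fromLimit l =>
    exact ⟨by
      have := (h.fromLimit l).1
      simp only [lowerBound, liftedConstraint]; nlinarith [norm_nonneg (z.x.sf l)],
      (h.fromLimit l).2⟩
  | toLimit l =>
    exact ⟨by
      have := (h.toLimit l).1
      simp only [lowerBound, liftedConstraint]; nlinarith [norm_nonneg (z.x.st l)],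
      (h.toLimit l).2⟩

theorem OPFFeasible.lift {x : OPFPoint V G E} (h : N.OPFFeasible x) (k : ConeKind) :
    N.RelaxedFeasible k (lift x) :=
  have hc := N.conic_lift k x
  { hermitian := outer_isHermitian _
    balance_eq := h.balance_eq
    from_eq := h.from_eq
    to_eq := h.to_eq
    voltage := fun i => by
      simp only [PowerNetwork.lift, re_outer_self]
      exact h.voltage i
    activeGen := h.activeGen
    reactiveGen := h.reactiveGen
    fromLimit := fun l => ⟨hc.from_sq l, h.fromLimit l⟩
    toLimit := fun l => ⟨hc.to_sq l, h.toLimit l⟩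
    active_sq := hc.active_sq
    reactive_sq := hc.reactive_sq
    mem_cone := hc.mem_cone }

/-- Links the active set in LICQ with the attained bounds that determine the signs of multipliers.
-/
theorem isActive_iff {x : OPFPoint V G E} (hx : N.OPFFeasible x) (c : ConstraintLabel V G E) :
    N.IsActive x c ↔
      N.constraintFun c x = N.lowerBound c ∨ N.constraintFun c x = N.upperBound c := by
  have hb := N.opfFeasible_iff.1 hx c
  cases c with
  | voltage i => exact Iff.rfl
  | activeGen g => exact Iff.rfl
  | reactiveGen g => exact Iff.rfl
  | fromLimit l =>
    refine ⟨Or.inr, fun h => h.resolve_left ?_⟩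
    simp only [lowerBound, constraintFun]
    nlinarith [norm_nonneg (x.sf l)]
  | toLimit l =>
    refine ⟨Or.inr, fun h => h.resolve_left ?_⟩
    simp only [lowerBound, constraintFun]
    nlinarith [norm_nonneg (x.st l)]
  | _ => exact ⟨fun _ => Or.inl (le_antisymm hb.2 hb.1), fun _ => trivial⟩

variable (N)

/-- Lifting makes the constraints affine; the demand is their only constant term. -/
theorem liftedConstraint_mixLift {a b : ℝ} (hab : a + b = 1) (c : ConstraintLabel V G E)
    (x y : OPFPoint V G E) : N.liftedConstraint c (mixLift a b x y) =
      a * N.liftedConstraint c (lift x) + b * N.liftedConstraint c (lift y) := by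
  obtain rfl : b = 1 - a := by linarith
  cases c <;>
  simp [liftedConstraint, mixLift, lift, balance, fromFlow, toFlow, mulVec_add, mulVec_smul,
    Matrix.add_mul, Matrix.mul_add] <;>
  ring

/-- Only occurring entries of `W` enter a constraint, and on the cone these are bounded by the trace
of the slack matrix. -/
theorem exists_abs_liftedConstraint_sub_le (k : ConeKind) (c : ConstraintLabel V G E) :
    ∃ C : ℝ, 0 ≤ C ∧ ∀ z, N.Conic k z →
      |N.liftedConstraint c z - N.liftedConstraint c (lift z.x)| ≤ C * gap z := by
  have row : ∀ (i : V) (y : V → ℂ), (∀ j, y j ≠ 0 → N.Occurs k i j) → ∃ C : ℝ, 0 ≤ C ∧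
      ∀ z : LiftedPoint V G E, N.Conic k z →
        ‖∑ j, (z.W - outer z.x.v) i j * star (y j)‖ ≤ C * gap z := by
    intro i y hy
    obtain ⟨C, hC, h⟩ := N.exists_norm_row_le k i y hy
    exact ⟨C, hC, fun z hz => (h _ hz.mem_cone).trans
      (mul_le_mul_of_nonneg_left hz.trace_le_gap hC)⟩
  have hbal : ∀ (z : LiftedPoint V G E) i,
      N.balance z.W z.x.s i - N.balance (outer z.x.v) z.x.s i =
        ∑ j, (z.W - outer z.x.v) i j * star (N.Ybus i j) := by
    intro z i
    simp only [balance, mul_apply, conjTranspose_apply, Matrix.sub_apply, sub_mul,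
      Finset.sum_sub_distrib]
    ring
  have hfrom : ∀ (z : LiftedPoint V G E) l,
      N.fromFlow z.W z.x.sf l - N.fromFlow (outer z.x.v) z.x.sf l =
        ∑ j, (z.W - outer z.x.v) (N.src l) j * star (N.Yfrom l j) := by
    intro z l
    simp only [fromFlow, Cfrom_mul_mul_apply, Matrix.sub_apply, sub_mul, Finset.sum_sub_distrib]
    ring
  have hto : ∀ (z : LiftedPoint V G E) l,
      N.toFlow z.W z.x.st l - N.toFlow (outer z.x.v) z.x.st l =
        ∑ j, (z.W - outer z.x.v) (N.tgt l) j * star (N.Yto l j) := by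
    intro z l
    simp only [toFlow, Cto_mul_mul_apply, Matrix.sub_apply, sub_mul, Finset.sum_sub_distrib]
    ring
  cases c with
  | balanceRe i =>
    obtain ⟨C, hC, h⟩ := row i (N.Ybus i) fun j hj => N.occurs_of_Ybus_ne_zero k hj
    refine ⟨C, hC, fun z hz => le_trans ?_ (h z hz)⟩
    rw [← hbal]
    simp only [liftedConstraint, lift]
    rw [← Complex.sub_re]
    exact Complex.abs_re_le_norm _
  | balanceIm i =>
    obtain ⟨C, hC, h⟩ := row i (N.Ybus i) fun j hj => N.occurs_of_Ybus_ne_zero k hj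
    refine ⟨C, hC, fun z hz => le_trans ?_ (h z hz)⟩
    rw [← hbal]
    simp only [liftedConstraint, lift]
    rw [← Complex.sub_im]
    exact Complex.abs_im_le_norm _
  | fromRe l =>
    obtain ⟨C, hC, h⟩ := row (N.src l) (N.Yfrom l) fun j hj => (N.occurs_of_Yfrom_ne_zero k hj).1
    refine ⟨C, hC, fun z hz => le_trans ?_ (h z hz)⟩
    rw [← hfrom]
    simp only [liftedConstraint, lift]
    rw [← Complex.sub_re]
    exact Complex.abs_re_le_norm _
  | fromIm l =>
    obtain ⟨C, hC, h⟩ := row (N.src l) (N.Yfrom l) fun j hj => (N.occurs_of_Yfrom_ne_zero k hj).1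
    refine ⟨C, hC, fun z hz => le_trans ?_ (h z hz)⟩
    rw [← hfrom]
    simp only [liftedConstraint, lift]
    rw [← Complex.sub_im]
    exact Complex.abs_im_le_norm _
  | toRe l =>
    obtain ⟨C, hC, h⟩ := row (N.tgt l) (N.Yto l) fun j hj => (N.occurs_of_Yto_ne_zero k hj).2
    refine ⟨C, hC, fun z hz => le_trans ?_ (h z hz)⟩
    rw [← hto]
    simp only [liftedConstraint, lift]
    rw [← Complex.sub_re]
    exact Complex.abs_re_le_norm _
  | toIm l =>
    obtain ⟨C, hC, h⟩ := row (N.tgt l) (N.Yto l) fun j hj => (N.occurs_of_Yto_ne_zero k hj).2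
    refine ⟨C, hC, fun z hz => le_trans ?_ (h z hz)⟩
    rw [← hto]
    simp only [liftedConstraint, lift]
    rw [← Complex.sub_im]
    exact Complex.abs_im_le_norm _
  | voltage i =>
    refine ⟨1, zero_le_one, fun z hz => ?_⟩
    have h1 := N.cone_diag_nonneg hz.mem_cone i
    have h2 := N.cone_diag_le_trace hz.mem_cone i
    have h3 := hz.trace_le_gap
    simp only [liftedConstraint, lift]
    rw [← Complex.sub_re, ← Matrix.sub_apply, abs_of_nonneg h1]
    linarith
  | activeGen g => exact ⟨0, le_rfl, fun z _ => by simp [liftedConstraint, lift]⟩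
  | reactiveGen g => exact ⟨0, le_rfl, fun z _ => by simp [liftedConstraint, lift]⟩
  | fromLimit l =>
    refine ⟨1, zero_le_one, fun z hz => ?_⟩
    simp only [liftedConstraint, lift]
    rw [abs_of_nonneg (sub_nonneg.2 (hz.from_sq l)), one_mul]
    exact hz.from_le_gap l
  | toLimit l =>
    refine ⟨1, zero_le_one, fun z hz => ?_⟩
    simp only [liftedConstraint, lift]
    rw [abs_of_nonneg (sub_nonneg.2 (hz.to_sq l)), one_mul]
    exact hz.to_le_gap l

/-! ### Smoothness -/

theorem contDiff_constraintFun (c : ConstraintLabel V G E) : ContDiff ℝ 1 (N.constraintFun c) := by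
  have hv : ∀ i, ContDiff ℝ 1 fun x : OPFPoint V G E => x.v i := fun i => by
    unfold OPFPoint.v; fun_prop
  have hs : ∀ i, ContDiff ℝ 1 fun x : OPFPoint V G E => x.s i := fun i => by
    unfold OPFPoint.s; fun_prop
  have hsf : ∀ i, ContDiff ℝ 1 fun x : OPFPoint V G E => x.sf i := fun i => by
    unfold OPFPoint.sf; fun_prop
  have hst : ∀ i, ContDiff ℝ 1 fun x : OPFPoint V G E => x.st i := fun i => by
    unfold OPFPoint.st; fun_prop
  have hout : ∀ i j, ContDiff ℝ 1 fun x : OPFPoint V G E => outer x.v i j := fun i j =>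
    (hv i).mul (Complex.conjCLE.contDiff.comp (hv j))
  have hbal : ∀ i, ContDiff ℝ 1 fun x : OPFPoint V G E => N.balance (outer x.v) x.s i := by
    intro i
    simp only [balance, mul_apply, mulVec, dotProduct]
    fun_prop
  have hfrom : ∀ l, ContDiff ℝ 1 fun x : OPFPoint V G E => N.fromFlow (outer x.v) x.sf l := by
    intro l
    simp only [fromFlow, Cfrom_mul_mul_apply]
    fun_prop
  have hto : ∀ l, ContDiff ℝ 1 fun x : OPFPoint V G E => N.toFlow (outer x.v) x.st l := by
    intro l
    simp only [toFlow, Cto_mul_mul_apply]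
    fun_prop
  cases c with
  | balanceRe i => exact Complex.reCLM.contDiff.comp (hbal i)
  | balanceIm i => exact Complex.imCLM.contDiff.comp (hbal i)
  | fromRe l => exact Complex.reCLM.contDiff.comp (hfrom l)
  | fromIm l => exact Complex.imCLM.contDiff.comp (hfrom l)
  | toRe l => exact Complex.reCLM.contDiff.comp (hto l)
  | toIm l => exact Complex.imCLM.contDiff.comp (hto l)
  | voltage i => exact (hv i).norm_sq ℝ
  | activeGen g => exact Complex.reCLM.contDiff.comp (hs g)
  | reactiveGen g => exact Complex.imCLM.contDiff.comp (hs g)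
  | fromLimit l => exact (hsf l).norm_sq ℝ
  | toLimit l => exact (hst l).norm_sq ℝ

theorem contDiff_cost : ContDiff ℝ 1 fun x : OPFPoint V G E => N.cost x.p := by
  have hp : ∀ g, ContDiff ℝ 1 fun x : OPFPoint V G E => x.p g := fun g =>
    N.contDiff_constraintFun (.activeGen g)
  unfold cost
  fun_prop

theorem contDiff_penalty_lift (M : Matrix V V ℂ) (x₀ : OPFPoint V G E) :
    ContDiff ℝ 1 fun x => penalty M x₀ (lift x) := by
  have hv : ∀ i, ContDiff ℝ 1 fun x : OPFPoint V G E => x.v i := fun i => by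
    unfold OPFPoint.v; fun_prop
  have hs : ∀ i, ContDiff ℝ 1 fun x : OPFPoint V G E => x.s i := fun i => by
    unfold OPFPoint.s; fun_prop
  have hsf : ∀ i, ContDiff ℝ 1 fun x : OPFPoint V G E => x.sf i := fun i => by
    unfold OPFPoint.sf; fun_prop
  have hst : ∀ i, ContDiff ℝ 1 fun x : OPFPoint V G E => x.st i := fun i => by
    unfold OPFPoint.st; fun_prop
  have hout : ∀ i j, ContDiff ℝ 1 fun x : OPFPoint V G E => outer (x.v - x₀.v) i j := fun i j =>
    ((hv i).sub contDiff_const).mul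
      (Complex.conjCLE.contDiff.comp ((hv j).sub contDiff_const))
  have htr : ContDiff ℝ 1 fun x : OPFPoint V G E => (outer (x.v - x₀.v) * M).trace.re := by
    refine Complex.reCLM.contDiff.comp ?_
    simp only [trace, diag_apply, mul_apply]
    fun_prop
  simp only [penalty_eq, lift, sub_self, zero_mul, trace_zero, Complex.zero_re,
    Finset.sum_const_zero, zero_add]
  refine ((htr.add (ContDiff.sum fun g _ => ?_)).add (ContDiff.sum fun l _ => ?_)).add
    (ContDiff.sum fun l _ => ?_)
  · exact ((hs g).sub contDiff_const).norm_sq ℝ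
  · exact ((hsf l).sub contDiff_const).norm_sq ℝ
  · exact ((hst l).sub contDiff_const).norm_sq ℝ

end PowerNetwork

/-! ### Sign conditions on multipliers -/

/-- A multiplier of the sign that fits the attained bounds penalizes no admissible value. -/
theorem mul_sub_nonpos_of_sign {lo hi b w t : ℝ} (h₁ : b ≠ lo → 0 ≤ w) (h₂ : b ≠ hi → w ≤ 0)
    (hlo : lo ≤ t) (hhi : t ≤ hi) : w * (t - b) ≤ 0 := by
  by_cases hl : b = lo <;> by_cases hh : b = hi
  · rw [show t = b by linarith, sub_self, mul_zero]
  · exact mul_nonpos_of_nonpos_of_nonneg (h₂ hh) (by linarith)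
  · exact mul_nonpos_of_nonneg_of_nonpos (h₁ hl) (by linarith)
  · rw [le_antisymm (h₂ hh) (h₁ hl), zero_mul]

section SignCone

variable {A : Type*}

/-- Multipliers with signs that fit the bounds `lo` and `hi` attained by the values `b`. -/
def signCone (lo hi b : A → ℝ) : Set (A → ℝ) :=
  {w | ∀ a, (b a ≠ lo a → 0 ≤ w a) ∧ (b a ≠ hi a → w a ≤ 0)}

variable {lo hi b : A → ℝ}

theorem zero_mem_signCone : 0 ∈ signCone lo hi b := fun _ => ⟨fun _ => le_rfl, fun _ => le_rfl⟩

theorem isClosed_signCone : IsClosed (signCone lo hi b) := by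
  have : signCone lo hi b = ⋂ a, ({w | b a ≠ lo a → 0 ≤ w a} ∩ {w | b a ≠ hi a → w a ≤ 0}) := by
    ext w; simp [signCone]
  rw [this]
  refine isClosed_iInter fun a => IsClosed.inter ?_ ?_
  · by_cases h : b a = lo a
    · simp [h]
    · simpa [h] using isClosed_le continuous_const (continuous_apply a)
  · by_cases h : b a = hi a
    · simp [h]
    · simpa [h] using isClosed_le (continuous_apply a) continuous_const

theorem convex_signCone : Convex ℝ (signCone lo hi b) := by
  intro w hw w' hw' s t hs ht _ a
  simp only [Pi.add_apply, Pi.smul_apply, smul_eq_mul]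
  refine ⟨fun h => ?_, fun h => ?_⟩
  · have := mul_nonneg hs ((hw a).1 h)
    have := mul_nonneg ht ((hw' a).1 h)
    linarith
  · have := mul_nonpos_of_nonneg_of_nonpos hs ((hw a).2 h)
    have := mul_nonpos_of_nonneg_of_nonpos ht ((hw' a).2 h)
    linarith

variable [Fintype A]

/-- If interior multipliers maximize the pairing with `d` then `d` points into the bounds. -/
theorem le_of_isMax_signCone {w d : A → ℝ} {r : ℝ} (hw : w ∈ signCone lo hi b) (hwr : ‖w‖ < r)
    (hmax : ∀ w' ∈ signCone lo hi b, ‖w'‖ ≤ r → ∑ a, w' a * d a ≤ ∑ a, w a * d a) (a : A) :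
    (b a = hi a → d a ≤ 0) ∧ (b a = lo a → 0 ≤ d a) := by
  classical
  -- The room r - ‖w‖ left in the ball allows one coordinate to be moved; an attained upper bound
  -- permits raising it, an attained lower bound lowering it.
  have step : ∀ t : ℝ, |t| = r - ‖w‖ → w + Pi.single a t ∈ signCone lo hi b → t * d a ≤ 0 := by
    intro t ht hmem
    have hn : ‖w + Pi.single a t‖ ≤ r := by
      refine (norm_add_le _ _).trans ?_
      rw [Pi.norm_single, Real.norm_eq_abs, ht]
      linarith
    have := hmax _ hmem hn
    simp only [Pi.add_apply, add_mul, Finset.sum_add_distrib] at this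
    have h2 : ∑ i, (Pi.single a t : A → ℝ) i * d i = t * d a := by
      rw [Finset.sum_eq_single a] <;> simp +contextual
    linarith
  have hpos : 0 < r - ‖w‖ := by linarith
  constructor
  · intro h
    have := step (r - ‖w‖) (abs_of_pos hpos) fun i => by
      by_cases hi : i = a
      · subst hi
        exact ⟨fun h' => by simpa using add_nonneg ((hw i).1 h') hpos.le, fun h' => absurd h h'⟩
      · simpa [hi] using hw i
    nlinarith
  · intro h
    have := step (-(r - ‖w‖)) (by rw [abs_neg, abs_of_pos hpos]) fun i => by
      by_cases hi : i = a
      · subst hi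
        exact ⟨fun h' => absurd h h', fun h' => by
          simp only [Pi.add_apply, Pi.single_eq_same]
          linarith [(hw i).2 h']⟩
      · simpa [hi] using hw i
    nlinarith

end SignCone

/-! ### The Lagrangian of the relaxation -/

namespace PowerNetwork

variable {V G E : Type*} [Fintype V] [DecidableEq V] [Fintype G] [Fintype E]
variable (N : PowerNetwork V G E) {k : ConeKind}

/-- The Lagrangian of the relaxation with respect to the constraints labelled by `A`. -/
noncomputable def liftedLagrangian {A : Type*} [Fintype A] (c : A → ConstraintLabel V G E)
    (M : Matrix V V ℂ) (x₀ : OPFPoint V G E) (δ : ℝ) (z : LiftedPoint V G E) (w : A → ℝ) : ℝ :=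
  penalty M x₀ z + δ * N.liftedCost z.o z.x.p +
    ∑ a, w a * (N.liftedConstraint (c a) z - N.constraintFun (c a) x₀)

variable {A : Type*} [Fintype A] {c : A → ConstraintLabel V G E} {M : Matrix V V ℂ}
  {x₀ : OPFPoint V G E}

theorem liftedLagrangian_lift (δ : ℝ) (x : OPFPoint V G E) (w : A → ℝ) :
    N.liftedLagrangian c M x₀ δ (lift x) w =
      lagrangian (fun x => penalty M x₀ (lift x)) (fun x => N.cost x.p)
        (fun a => N.constraintFun (c a)) x₀ δ x w := by
  simp only [liftedLagrangian, lagrangian, liftedConstraint_lift]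
  rfl

theorem liftedLagrangian_mixLift {s t : ℝ} (hst : s + t = 1) (δ : ℝ) (x y : OPFPoint V G E)
    (w : A → ℝ) : N.liftedLagrangian c M x₀ δ (mixLift s t x y) w =
      s * N.liftedLagrangian c M x₀ δ (lift x) w +
        t * N.liftedLagrangian c M x₀ δ (lift y) w := by
  have hsum : ∑ a, w a * (N.liftedConstraint (c a) (mixLift s t x y) - N.constraintFun (c a) x₀) =
      s * (∑ a, w a * (N.liftedConstraint (c a) (lift x) - N.constraintFun (c a) x₀)) +
      t * ∑ a, w a * (N.liftedConstraint (c a) (lift y) - N.constraintFun (c a) x₀) := by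
    rw [Finset.mul_sum, Finset.mul_sum, ← Finset.sum_add_distrib]
    refine Finset.sum_congr rfl fun a _ => ?_
    rw [N.liftedConstraint_mixLift hst]
    linear_combination (w a * N.constraintFun (c a) x₀) * hst
  rw [liftedLagrangian, hsum, penalty_mixLift hst, N.liftedCost_mixLift hst]
  simp only [liftedLagrangian]
  change _ = s * (_ + δ * N.cost x.p + _) + t * (_ + δ * N.cost y.p + _)
  ring

/-- For small multipliers, slack of the conic constraints is penalized by the Lagrangian. -/
theorem exists_gap_le_liftedLagrangian (c : A → ConstraintLabel V G E) (x₀ : OPFPoint V G E)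
    {ε : ℝ} (hε : 0 < ε) (hε1 : ε ≤ 1)
    (hM : ∀ H ∈ N.cone k, ε * H.trace.re ≤ (H * M).trace.re) :
    ∃ r : ℝ, 0 < r ∧ ∀ δ : ℝ, 0 ≤ δ → ∀ w : A → ℝ, ‖w‖ ≤ r → ∀ z, N.Conic k z →
      N.liftedLagrangian c M x₀ δ (lift z.x) w + ε / 2 * gap z ≤
        N.liftedLagrangian c M x₀ δ z w := by
  choose C hC hCle using fun a => N.exists_abs_liftedConstraint_sub_le k (c a)
  have hCsum : 0 ≤ ∑ a, C a := Finset.sum_nonneg fun a _ => hC a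
  -- With this radius the constraint terms cost at most half of the ε · `gap z` gained from the
  -- penalty.
  refine ⟨ε / (2 * (∑ a, C a + 1)), by positivity, fun δ hδ w hw z hz => ?_⟩
  have h1 := mul_gap_le_penalty_sub (x₀ := x₀) hε1 hM hz
  have h2 : δ * N.liftedCost (lift z.x).o (lift z.x).x.p ≤ δ * N.liftedCost z.o z.x.p :=
    mul_le_mul_of_nonneg_left (N.cost_le_liftedCost hz) hδ
  have hg := hz.gap_nonneg
  have h3 : ∑ a, w a * (N.liftedConstraint (c a) (lift z.x) - N.constraintFun (c a) x₀) -
      ∑ a, w a * (N.liftedConstraint (c a) z - N.constraintFun (c a) x₀) ≤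
        ∑ a, ‖w‖ * (C a * gap z) := by
    rw [← Finset.sum_sub_distrib]
    refine Finset.sum_le_sum fun a _ => ?_
    calc _ = -w a * (N.liftedConstraint (c a) z - N.liftedConstraint (c a) (lift z.x)) := by ring
      _ ≤ |-w a * (N.liftedConstraint (c a) z - N.liftedConstraint (c a) (lift z.x))| :=
        le_abs_self _
      _ = |w a| * |N.liftedConstraint (c a) z - N.liftedConstraint (c a) (lift z.x)| := by
        rw [abs_mul, abs_neg]
      _ ≤ ‖w‖ * (C a * gap z) :=
        mul_le_mul (norm_le_pi_norm w a) (hCle a z hz) (abs_nonneg _) (norm_nonneg _)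
  have h4 : ∑ a, ‖w‖ * (C a * gap z) ≤ ε / 2 * gap z := by
    rw [← Finset.mul_sum, ← Finset.sum_mul, ← mul_assoc]
    refine mul_le_mul_of_nonneg_right ?_ hg
    have := (le_div_iff₀ (by positivity)).1 hw
    nlinarith [norm_nonneg w]
  unfold liftedLagrangian
  linarith

/-- Near a feasible point, bounds that are not attained there continue to hold. -/
theorem eventually_inactive_bounds {N : PowerNetwork V G E} (hx₀ : N.OPFFeasible x₀) :
    ∀ᶠ x in nhds x₀, ∀ c,
      (N.constraintFun c x₀ ≠ N.lowerBound c → N.lowerBound c ≤ N.constraintFun c x) ∧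
      (N.constraintFun c x₀ ≠ N.upperBound c → N.constraintFun c x ≤ N.upperBound c) := by
  rw [Filter.eventually_all]
  intro c
  have hc := (N.contDiff_constraintFun c).continuous.tendsto x₀
  have hb := N.opfFeasible_iff.1 hx₀ c
  refine Filter.Eventually.and ?_ ?_
  · by_cases h : N.constraintFun c x₀ = N.lowerBound c
    · exact Filter.Eventually.of_forall fun _ h' => absurd h h'
    · filter_upwards [hc.eventually_const_lt (lt_of_le_of_ne hb.1 (Ne.symm h))] with x hx _
      exact hx.le
  · by_cases h : N.constraintFun c x₀ = N.upperBound c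
    · exact Filter.Eventually.of_forall fun _ h' => absurd h h'
    · filter_upwards [hc.eventually_lt_const (lt_of_le_of_ne hb.2 h)] with x hx _
      exact hx.le

end PowerNetwork

/-! ### Exactness of the penalized relaxation -/

theorem theorem1 {V G E : Type*} [Fintype V] [DecidableEq V] [Fintype G] [Fintype E]
    (N : PowerNetwork V G E) (k : ConeKind) (M : Matrix V V ℂ) (x₀ : OPFPoint V G E)
    (hx₀ : N.OPFFeasible x₀) (hLICQ : N.LICQ x₀) (hM : M ∈ N.dualInterior k) :
    ∃ μ₀ : ℝ, 0 < μ₀ ∧ ∀ μ : ℝ, μ₀ ≤ μ →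
      ∃ z : LiftedPoint V G E,
        N.IsRelaxedSolution k M x₀ μ z ∧
        (∀ z', N.IsRelaxedSolution k M x₀ μ z' → N.Agree k z' z) ∧
        z.W = outer z.x.v ∧
        N.OPFFeasible z.x ∧
        N.cost z.x.p ≤ N.cost x₀.p := by
  classical
  open PowerNetwork in
  have := Fintype.ofFinite (ConstraintLabel V G E)
  let A := {c : ConstraintLabel V G E // N.IsActive x₀ c}
  let c : A → ConstraintLabel V G E := Subtype.val
  obtain ⟨ε, hε, hε1, hMε⟩ := exists_mul_trace_le hM
  obtain ⟨r, hr, hgap⟩ := N.exists_gap_le_liftedLagrangian c x₀ hε hε1 hMε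
  let L : ℝ → OPFPoint V G E → (A → ℝ) → ℝ :=
    lagrangian (fun x => penalty M x₀ (lift x)) (fun x => N.cost x.p)
      (fun a => N.constraintFun (c a)) x₀
  -- Strong convexity: the lifted Lagrangian is affine along mixtures of lifts, and passing from the
  -- mixture to the lift of its point gains a multiple of the gap.
  have hstrong : ∀ δ : ℝ, 0 ≤ δ → ∀ w : A → ℝ, ‖w‖ ≤ r → ∀ x y : OPFPoint V G E,
      ∀ s t : ℝ, 0 ≤ s → 0 ≤ t → s + t = 1 →
      L δ (s • x + t • y) w + ε / 2 * (s * t * OPFPoint.sqNorm (x - y)) ≤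
        s * L δ x w + t * L δ y w := by
    intro δ hδ w hw x y s t hs ht hst
    have := hgap δ hδ w hw _ (N.conic_mixLift k hs ht hst x y)
    rw [gap_mixLift hst, N.liftedLagrangian_mixLift hst] at this
    simp only [liftedLagrangian_lift] at this
    exact this
  have hsq : ∀ x : OPFPoint V G E, 0 ≤ OPFPoint.sqNorm x := fun x =>
    (sq_nonneg ‖x‖).trans (OPFPoint.norm_sq_le_sqNorm x)
  have hgrow : ∀ x, ε * ‖x - x₀‖ ^ 2 ≤ penalty M x₀ (lift x) := fun x =>
    (mul_le_mul_of_nonneg_left (OPFPoint.norm_sq_le_sqNorm _) hε.le).trans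
      (mul_sqNorm_le_penalty_lift hε1 hMε x)
  obtain ⟨δ₀, hδ₀, hsaddle⟩ := exists_saddle (contDiff_penalty_lift M x₀) N.contDiff_cost
    (fun a => N.contDiff_constraintFun (c a)) hε hgrow (penalty_lift_self M x₀) hLICQ
    (S := signCone (fun a => N.lowerBound (c a)) (fun a => N.upperBound (c a))
      (fun a => N.constraintFun (c a) x₀))
    isClosed_signCone convex_signCone zero_mem_signCone hr
    (fun δ hδ w hw => ⟨convex_univ, fun x _ y _ s t hs ht hst => by
      have := hstrong δ hδ w hw x y s t hs ht hst
      have := mul_nonneg (by positivity : 0 ≤ ε / 2 * (s * t)) (hsq (x - y))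
      simp only [smul_eq_mul]
      simp only [L] at *
      linarith⟩)
    (eventually_inactive_bounds hx₀)
  refine ⟨δ₀⁻¹, inv_pos.2 hδ₀, fun μ hμ => ?_⟩
  have hμpos : 0 < μ := (inv_pos.2 hδ₀).trans_le hμ
  set δ : ℝ := μ⁻¹ with hδ
  have hδpos : 0 < δ := inv_pos.2 hμpos
  obtain ⟨x, hxU, w, hwS, hwr, hmin, hmax⟩ := hsaddle δ hδpos (inv_le_of_inv_le₀ hδ₀ hμ)
  -- Bounds attained at `x₀` hold by maximality in w; the remaining ones hold because x lies in the
  -- chosen neighbourhood.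
  have hxfeas : N.OPFFeasible x := N.opfFeasible_iff.2 fun i => by
    by_cases hi : N.IsActive x₀ i
    · have h := le_of_isMax_signCone
        (d := fun a => N.constraintFun (c a) x - N.constraintFun (c a) x₀) hwS hwr hmax ⟨i, hi⟩
      constructor
      · by_cases hlo : N.constraintFun i x₀ = N.lowerBound i
        · have := h.2 hlo
          simp only [c] at this
          linarith
        · exact (hxU i).1 hlo
      · by_cases hhi : N.constraintFun i x₀ = N.upperBound i
        · have := h.1 hhi
          simp only [c] at this
          linarith
        · exact (hxU i).2 hhi
    · rw [isActive_iff hx₀, not_or] at hi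
      exact ⟨(hxU i).1 hi.1, (hxU i).2 hi.2⟩
  have hobj : ∀ z, δ * N.relaxedObjective M x₀ μ z =
      penalty M x₀ z + δ * N.liftedCost z.o z.x.p := fun z => by
    rw [relaxedObjective, mul_add, ← mul_assoc, hδ, inv_mul_cancel₀ hμpos.ne']
    ring
  -- Comparing w with the multiplier 0 shows that the constraint terms at x have nonnegative sum.
  have hLx : δ * N.relaxedObjective M x₀ μ (lift x) ≤ L δ x w := by
    have h0 := hmax 0 zero_mem_signCone (by simpa using hr.le)
    simp only [Pi.zero_apply, zero_mul, Finset.sum_const_zero] at h0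
    rw [hobj]
    exact le_add_of_nonneg_right h0
  -- Weak duality: at a feasible point the signed constraint terms are nonpositive.
  have hlower : ∀ z, N.RelaxedFeasible k z →
      L δ z.x w + ε / 2 * gap z ≤ δ * N.relaxedObjective M x₀ μ z := by
    intro z hz
    have h1 := hgap δ hδpos.le w hwr.le z hz.conic
    rw [liftedLagrangian_lift] at h1
    refine h1.trans ?_
    rw [hobj]
    exact add_le_of_nonpos_right (Finset.sum_nonpos fun a _ =>
      mul_sub_nonpos_of_sign (hwS a).1 (hwS a).2 (hz.bounds _).1 (hz.bounds _).2)
  have hopt : ∀ z, N.RelaxedFeasible k z →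
      N.relaxedObjective M x₀ μ (lift x) ≤ N.relaxedObjective M x₀ μ z := by
    intro z hz
    have h1 := hlower z hz
    have h2 : L δ x w ≤ L δ z.x w := hmin z.x
    have h3 := mul_nonneg (half_pos hε).le hz.conic.gap_nonneg
    exact le_of_mul_le_mul_left (by linarith) hδpos
  refine ⟨lift x, ⟨hxfeas.lift k, hopt⟩, fun z hz => ?_, rfl, hxfeas, ?_⟩
  · have h1 := hlower z hz.1
    have h2 : L δ x w ≤ L δ z.x w := hmin z.x
    have h3 : δ * N.relaxedObjective M x₀ μ z ≤ δ * N.relaxedObjective M x₀ μ (lift x) :=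
      mul_le_mul_of_nonneg_left (hz.2 _ (hxfeas.lift k)) hδpos.le
    have h4 := mul_nonneg (half_pos hε).le hz.1.conic.gap_nonneg
    have hgap0 : gap z ≤ 0 := by
      by_contra! hpos
      have := mul_pos (half_pos hε) hpos
      linarith
    have hzx : z.x = x := by
      -- Both points minimize the Lagrangian, so strong convexity at their midpoint forces them to
      -- coincide.
      have h5 := hstrong δ hδpos.le w hwr.le z.x x (1 / 2) (1 / 2) (by norm_num) (by norm_num)
        (by norm_num)
      have h6 : L δ x w ≤ L δ ((1 / 2 : ℝ) • z.x + (1 / 2 : ℝ) • x) w := hmin _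
      have h7 : ε / 8 * ‖z.x - x‖ ^ 2 ≤ 0 := by
        have := mul_le_mul_of_nonneg_left (OPFPoint.norm_sq_le_sqNorm (z.x - x)) hε.le
        linarith
      have h8 : ‖z.x - x‖ ^ 2 ≤ 0 := nonpos_of_mul_nonpos_right h7 (by positivity)
      have h9 : ‖z.x - x‖ = 0 := pow_eq_zero_iff two_ne_zero |>.1 (le_antisymm h8 (sq_nonneg _))
      exact sub_eq_zero.1 (norm_eq_zero.1 h9)
    rw [← hzx]
    exact hz.1.conic.agree_lift hgap0
  -- The lift of `x₀` is a feasible competitor with zero penalty.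
  · have h1 := mul_le_mul_of_nonneg_left (hopt _ (hx₀.lift k)) hδpos.le
    rw [hobj, hobj, penalty_lift_self] at h1
    have h2 : 0 ≤ penalty M x₀ (lift x) := le_trans (by positivity) (hgrow x)
    exact le_of_mul_le_mul_left
      (show δ * N.liftedCost (lift x).o (lift x).x.p ≤
        δ * N.liftedCost (lift x₀).o (lift x₀).x.p by linarith) hδpos
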